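/- Let $(\phi_t)_{t\ge 0}$ be a non-elliptic one-parameter semigroup of holomorphic self-maps of the unit disk $\mathbb D$ which does not extend to a group of automorphisms: $\phi_0=\mathrm{id}$, $\phi_{s+t}=\phi_s\circ\phi_t$, the map $t\mapsto\phi_t$ is continuous for locally uniform convergence, no $\phi_t$ with $t>0$ is an automorphism of $\mathbb D$, and the Denjoy–Wolff point $\tau$ (the common limit in $\overline{\mathbb D}$ of all forward orbits $t\mapsto\phi_t(z)$ as $t\to+\infty$) lies on $\partial\mathbb D$. Let $h$ be its Koenigs function, i.e. an injective holomorphic function $h:\mathbb D\to\mathbb C$ with $h(\phi_t(z))=h(z)+t$ for all $z\in\mathbb D$, $t\ge 0$, and let $\Omega:=h(\mathbb D)$ be the Koenigs domain. A *petal* is a connected component $\Delta$ of the interior of $\bigcap_{t\ge0}\phi_t(\mathbb D)$. A *backward orbit* is a continuous curve $\gamma:[0,+\infty)\to\mathbb D$ with $\phi_s(\gamma(t))=\gamma(t-s)$ for $0<s<t$; the *$\alpha$-point* of $\Delta$ is the common limit $\sigma$, as $t\to+\infty$, of all backward orbits starting in $\Delta$; the petal is *hyperbolic* if $\sigma\ne\tau$.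 Write $\mathbb S(a,b):=\{z: a<\operatorname{Im}z<b\}$ for real $a<b$; such a strip is a *maximal strip* in $\Omega$ if it is contained in $\Omega$ and in no other strip $\mathbb S(a',b')\subset\Omega$. **Proposition.** Let $\Delta(\sigma)$ be a hyperbolic petal of $(\phi_t)$ with $\alpha$-point $\sigma$. Then $h(\Delta(\sigma))$ is a maximal strip $S=\mathbb S(a,b)$ in $\Omega$, and the following two conditions are equivalent: 1. $\Delta(\sigma)$ is conformal at $\sigma$ with respect to $\mathbb D$: there is a conformal mapping $\varphi$ of $\mathbb D$ onto $\Delta(\sigma)$ which has angular limit $\sigma$ at $1$ and for which the angular limit of $(\varphi(z)-\sigma)/(z-1)$ at $z=1$ exists and is finite. 2. $\Omega$ is conformal at $-\infty$ with respect to $S$: there is a conformal mapping $g$ of $\Omega$ onto $S$ such that $\operatorname{Re}g(t+iy_0)\to-\infty$ as $t\to-\infty$ for some $y_0\in(a,b)$ and such that for every $\varepsilon\in(0,b-a)$ the limit of $g(z)-z$ as $z\to\infty$ within $D(\varepsilon):=\{z\in S:\operatorname{Re}z\le0,\ \operatorname{dist}(z,\partial S)\ge\varepsilon/2\}$ exists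 and is a finite real number. -/

import Mathlib

open Set Filter Topology

/-- The open unit disk. -/
def unitDisk : Set ℂ := Metric.ball 0 1

/-- `f` is a conformal (injective holomorphic) mapping of `U` onto `V`. -/
structure IsConformalOnto (f : ℂ → ℂ) (U V : Set ℂ) : Prop where
  holo : DifferentiableOn ℂ f U
  inj : InjOn f U
  image_eq : f '' U = V

/-- `(φ t)`, `t ≥ 0`, is a one-parameter semigroup of holomorphic self-maps of the unit disk:
a semigroup homomorphism from `[0, ∞)` to the holomorphic self-maps of the disk, continuous for
the topology of locally uniform convergence. Values of `φ t z` for `t < 0` or `z` outside the disk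
play no role. -/
structure IsOneParameterSemigroup (φ : ℝ → ℂ → ℂ) : Prop where
  mapsTo : ∀ t, 0 ≤ t → MapsTo (φ t) unitDisk unitDisk
  holo : ∀ t, 0 ≤ t → DifferentiableOn ℂ (φ t) unitDisk
  zero : ∀ z ∈ unitDisk, φ 0 z = z
  add : ∀ s t, 0 ≤ s → 0 ≤ t → ∀ z ∈ unitDisk, φ (s + t) z = φ s (φ t z)
  continuous : ∀ t, 0 ≤ t → TendstoLocallyUniformlyOn φ (φ t) (𝓝[Ici 0] t) unitDisk

/-- `φ t` is an automorphism of the unit disk for no `t > 0`, that is, the semigroup does not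
extend to a one-parameter group of automorphisms. -/
def NotGroup (φ : ℝ → ℂ → ℂ) : Prop :=
  ∀ t, 0 < t → ¬ BijOn (φ t) unitDisk unitDisk

/-- `τ` is the Denjoy-Wolff point of the semigroup: the point of the closed unit disk to which all
forward orbits converge. -/
def IsDenjoyWolffPoint (φ : ℝ → ℂ → ℂ) (τ : ℂ) : Prop :=
  τ ∈ Metric.closedBall (0 : ℂ) 1 ∧ ∀ z ∈ unitDisk, Tendsto (fun t => φ t z) atTop (𝓝 τ)

/-- The semigroup is non-elliptic: its Denjoy-Wolff point lies on the unit circle. -/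
def IsNonElliptic (φ : ℝ → ℂ → ℂ) : Prop :=
  ∃ τ ∈ Metric.sphere (0 : ℂ) 1, IsDenjoyWolffPoint φ τ

/-- `h` is a Koenigs function of the (non-elliptic) semigroup: an injective holomorphic solution
of Abel's equation. The base space of the corresponding holomorphic model is the union of the
translates `h(𝔻) - t`, `t ≥ 0`. -/
structure IsKoenigsFunction (φ : ℝ → ℂ → ℂ) (h : ℂ → ℂ) : Prop where
  holo : DifferentiableOn ℂ h unitDisk
  inj : InjOn h unitDisk
  abel : ∀ t : ℝ, 0 ≤ t → ∀ z ∈ unitDisk, h (φ t z) = h z + t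

/-- The backward invariant set of the semigroup. -/
def backwardInvariantSet (φ : ℝ → ℂ → ℂ) : Set ℂ :=
  ⋂ t ∈ Ici (0 : ℝ), φ t '' unitDisk

/-- A petal: a connected component of the interior of the backward invariant set. -/
def IsPetal (φ : ℝ → ℂ → ℂ) (Δ : Set ℂ) : Prop :=
  ∃ z ∈ interior (backwardInvariantSet φ),
    Δ = connectedComponentIn (interior (backwardInvariantSet φ)) z

/-- A backward orbit `γ : [0, ∞) → 𝔻` of the semigroup. -/
structure IsBackwardOrbit (φ : ℝ → ℂ → ℂ) (γ : ℝ → ℂ) : Prop where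
  mapsTo : MapsTo γ (Ici 0) unitDisk
  continuousOn : ContinuousOn γ (Ici 0)
  orbit : ∀ t, 0 < t → ∀ s ∈ Ioo 0 t, φ s (γ t) = γ (t - s)

/-- `σ` is the `α`-point of `Δ`: the common limit of all backward orbits starting inside `Δ`. -/
def IsAlphaPoint (φ : ℝ → ℂ → ℂ) (Δ : Set ℂ) (σ : ℂ) : Prop :=
  ∀ γ : ℝ → ℂ, IsBackwardOrbit φ γ → γ 0 ∈ Δ → Tendsto γ atTop (𝓝 σ)

/-- `Δ` is a hyperbolic petal with `α`-point `σ`: a petal whose `α`-point `σ` is not the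
Denjoy-Wolff point. -/
structure IsHyperbolicPetal (φ : ℝ → ℂ → ℂ) (Δ : Set ℂ) (σ : ℂ) : Prop where
  petal : IsPetal φ Δ
  alpha : IsAlphaPoint φ Δ σ
  ne_dw : ¬ IsDenjoyWolffPoint φ σ

/-- The horizontal strip `{z : a < Im z < b}`. -/
def hstrip (a b : ℝ) : Set ℂ := {z | a < z.im ∧ z.im < b}

/-- `hstrip a b` is a maximal strip contained in `Ω`. -/
def IsMaximalStrip (Ω : Set ℂ) (a b : ℝ) : Prop :=
  a < b ∧ hstrip a b ⊆ Ω ∧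
    ∀ a' b' : ℝ, a' < b' → hstrip a b ⊆ hstrip a' b' → hstrip a' b' ⊆ Ω → a' = a ∧ b' = b

/-- The function `f` on the unit disk has angular (non-tangential) limit `L` at the point `1`.
Here `Complex.stolzSet M = {z | ‖z‖ < 1 ∧ ‖1 - z‖ < M * (1 - ‖z‖)}`. -/
def HasAngularLimitAtOne (f : ℂ → ℂ) (L : ℂ) : Prop :=
  ∀ M : ℝ, Tendsto f (𝓝[Complex.stolzSet M] 1) (𝓝 L)

/-- A (simply connected) domain `U` in the unit disk is conformal at the point `σ` of `∂U ∩ ∂𝔻`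
with respect to `𝔻`: some conformal mapping `f` of `𝔻` onto `U` has angular limit `σ` at `1` and a
finite angular derivative at `1`. -/
def IsConformalInDiskAt (U : Set ℂ) (σ : ℂ) : Prop :=
  ∃ f : ℂ → ℂ, IsConformalOnto f unitDisk U ∧ HasAngularLimitAtOne f σ ∧
    ∃ d : ℂ, HasAngularLimitAtOne (fun z => (f z - σ) / (z - 1)) d

/-- The set `D(ε)` of points of the strip in the closed left half-plane, at distance at least
`ε / 2` from the boundary of the strip. -/
def stripTail (a b ε : ℝ) : Set ℂ :=
  {z | z ∈ hstrip a b ∧ z.re ≤ 0 ∧ ε / 2 ≤ Metric.infDist z (frontier (hstrip a b))}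

/-- The domain `Ω` is conformal at `-∞` with respect to its maximal strip `hstrip a b`: for a
conformal mapping `g` of `Ω` onto the strip with `Re g(t + i y₀) → -∞` as `t → -∞`, the difference
`g z - z` has a finite real limit as `z → ∞` in each of the sets `D(ε)`, `0 < ε < b - a`. -/
def IsConformalAtNegInfty (Ω : Set ℂ) (a b : ℝ) : Prop :=
  ∃ g : ℂ → ℂ, IsConformalOnto g Ω (hstrip a b) ∧
    (∃ y₀ ∈ Ioo a b, Tendsto (fun t : ℝ => (g (t + y₀ * Complex.I)).re) atBot atBot) ∧
    ∀ ε ∈ Ioo 0 (b - a), ∃ c : ℝ,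
      Tendsto (fun z => g z - z) (Bornology.cobounded ℂ ⊓ 𝓟 (stripTail a b ε)) (𝓝 (c : ℂ))

/-!
In the Koenigs coordinate `w = h z` the semigroup acts by the translations `w ↦ w + t`, so the
backward invariant set corresponds to the union of the horizontal lines contained in
`Ω = h '' unitDisk`, and a petal to a strip, a half-plane or the plane. Everything else is deduced
from the Schwarz–Pick inequality. Write `P z = (1 - ‖z‖ ^ 2) / ‖σ - z‖ ^ 2` for the Poisson kernel
with pole at the `α`-point and `k` for the inverse of `h`.

*The petal is a strip.* Along a backward orbit `s ↦ k (w - s)` whose image runs in the middle of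
a strip of half-width `R`, the hyperbolic step of `φ t` is bounded in terms of `t / R`; Julia's
lemma turns this into `P z ≤ (1 + t / R) / (1 - t / R) * P (φ t z)` for all `z`
(`julia_semigroup`). If `R` can be taken arbitrarily large, then `P` increases along forward orbits
and the Denjoy–Wolff point is `σ` (`alphaPoint_eq_of_unbounded`). Hence the image of a hyperbolic
petal is a bounded strip `S = hstrip a b`, and it is maximal because `Δ` is a whole component.

*Strip coordinates.* Let `stripMap a b` be the standard conformal map of the disk onto `S` sending
`1` to `-∞`. Stolz angles at `1` correspond to the sets `stripTail`, and for a self-map `F` of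
the disk with `F → 1` at `1` that corresponds to a self-map `g` of `S`, the quotient
`(1 - F ζ) / (1 - ζ)` behaves like `exp (π (g w - w) / (b - a))`. So a finite real limit of
`g w - w` is the same as a positive angular derivative of `F`; an angular derivative of a self-map
of the disk is automatically nonzero by Schwarz–Pick and positive because `F` stays in the disk.

*Comparison.* A conformal map `g` of `Ω` onto `S` amounts to an automorphism of the disk, namely
`stripInv a b ∘ g ∘ h`, which extends differentiably to the boundary. This compares the self-map
`F` with the map `k ∘ stripMap a b` onto the petal. Finally, an arbitrary conformal map `f` of
the disk onto the petal differs from `k ∘ stripMap a b` by an automorphism `m`, and one has to know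
that `m` fixes `1` if `f` has limit `σ` and a finite angular derivative at `1`
(`tendsto_stripInv_comp_one`). A finite angular derivative forces `P (f r) → ∞` as `r → 1`, whereas
`P ∘ k` is bounded on bounded parts of `S` (`exists_poisson_le`): by Julia's inequality a large
value would propagate to a horizontal segment, and by the maximum principle on a square to a compact
subset of `S`. So `h (f r)` tends to `-∞` or `+∞`, and `+∞` is excluded since forward orbits tend
to the Denjoy–Wolff point, which is not `σ`.
-/

open ComplexConjugate

/-! ### The Schwarz–Pick inequality and its consequences -/

theorem mem_unitDisk {z : ℂ} : z ∈ unitDisk ↔ ‖z‖ < 1 := by simp [unitDisk]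

theorem isOpen_unitDisk : IsOpen unitDisk := Metric.isOpen_ball

theorem zero_mem_unitDisk : (0 : ℂ) ∈ unitDisk := by simp [unitDisk]

theorem norm_one_sub_conj_mul_sq (z w : ℂ) :
    ‖1 - conj w * z‖ ^ 2 = ‖z - w‖ ^ 2 + (1 - ‖z‖ ^ 2) * (1 - ‖w‖ ^ 2) := by
  simp only [Complex.sq_norm, Complex.normSq_apply]
  simp
  ring

theorem one_sub_conj_mul_ne_zero {z w : ℂ} (hz : ‖z‖ < 1) (hw : ‖w‖ ≤ 1) :
    1 - conj w * z ≠ 0 := by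
  intro h
  have h1 : ‖conj w * z‖ = 1 := by rw [← sub_eq_zero.mp h]; simp
  rw [norm_mul, RCLike.norm_conj] at h1
  nlinarith [norm_nonneg z, norm_nonneg w]

/-- The Möbius automorphism `z ↦ (z - α) / (1 - conj α * z)` of the disk, which sends `α` to `0`. -/
noncomputable def diskMobius (α z : ℂ) : ℂ := (z - α) / (1 - conj α * z)

theorem diskMobius_mem {α z : ℂ} (hα : α ∈ unitDisk) (hz : z ∈ unitDisk) :
    diskMobius α z ∈ unitDisk := by
  rw [mem_unitDisk] at *
  have h0 := norm_pos_iff.mpr (one_sub_conj_mul_ne_zero hz hα.le)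
  rw [diskMobius, norm_div, div_lt_one h0]
  have h1 := norm_one_sub_conj_mul_sq z α
  have h2 : 0 < (1 - ‖z‖ ^ 2) * (1 - ‖α‖ ^ 2) := by
    apply mul_pos <;> nlinarith [norm_nonneg z, norm_nonneg α]
  exact lt_of_pow_lt_pow_left₀ 2 h0.le (by linarith)

theorem diskMobius_neg_comp {α z : ℂ} (hα : α ∈ unitDisk) (hz : z ∈ unitDisk) :
    diskMobius (-α) (diskMobius α z) = z := by
  rw [mem_unitDisk] at *
  have h0 := one_sub_conj_mul_ne_zero hz hα.le
  have h1 := one_sub_conj_mul_ne_zero hα hα.le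
  have h2 : 1 - conj α * z + conj α * (z - α) ≠ 0 := by
    convert h1 using 1; ring
  obtain ⟨D, hD⟩ : ∃ D, D = 1 - conj α * z := ⟨_, rfl⟩
  simp only [diskMobius, map_neg]
  rw [← hD] at h0 h2 ⊢
  have h3 : 1 - -conj α * ((z - α) / D) = (D + conj α * (z - α)) / D := by
    field_simp
    ring
  rw [h3, div_div_eq_mul_div, div_eq_iff h2, sub_mul, div_mul_cancel₀ _ h0, hD]
  ring

theorem diskMobius_comp_neg {α z : ℂ} (hα : α ∈ unitDisk) (hz : z ∈ unitDisk) :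
    diskMobius α (diskMobius (-α) z) = z := by
  simpa using diskMobius_neg_comp (α := -α) (by simpa [unitDisk] using hα) hz

theorem differentiableAt_diskMobius {α z : ℂ} (hα : α ∈ unitDisk) (hz : ‖z‖ ≤ 1) :
    DifferentiableAt ℂ (diskMobius α) z := by
  have h0 : 1 - conj α * z ≠ 0 := by
    have := one_sub_conj_mul_ne_zero (mem_unitDisk.mp hα) hz
    intro h
    apply this
    have := congrArg conj h
    simpa [mul_comm] using this
  unfold diskMobius
  fun_prop (disch := assumption)

theorem differentiableOn_diskMobius {α : ℂ} (hα : α ∈ unitDisk) :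
    DifferentiableOn ℂ (diskMobius α) unitDisk := fun _ hz =>
  (differentiableAt_diskMobius hα (mem_unitDisk.mp hz).le).differentiableWithinAt

/-- The Schwarz lemma for maps of a disk of radius `R` into the unit disk, without normalization
at the centre. -/
theorem norm_sub_mul_le_of_mapsTo_ball {f : ℂ → ℂ} {c z : ℂ} {R : ℝ}
    (hf : DifferentiableOn ℂ f (Metric.ball c R)) (hm : MapsTo f (Metric.ball c R) unitDisk)
    (hz : z ∈ Metric.ball c R) :
    ‖f z - f c‖ * R ≤ ‖z - c‖ * ‖1 - conj (f c) * f z‖ := by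
  have hR : 0 < R := Metric.nonempty_ball.mp ⟨z, hz⟩
  have hc : f c ∈ unitDisk := hm (Metric.mem_ball_self hR)
  have h1 := Complex.dist_le_div_mul_dist_of_mapsTo_ball (f := fun z => diskMobius (f c) (f z))
    (c := c) (R₁ := R) (R₂ := 1) ((differentiableOn_diskMobius hc).comp hf hm)
    (fun w hw => by
      have h2 : diskMobius (f c) (f c) = 0 := by simp [diskMobius]
      rw [h2]
      exact Metric.ball_subset_closedBall (diskMobius_mem hc (hm hw))) hz
  have h0 := norm_pos_iff.mpr
    (one_sub_conj_mul_ne_zero (mem_unitDisk.mp (hm hz)) (mem_unitDisk.mp hc).le)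
  simp only [dist_eq_norm_sub] at h1
  rw [show diskMobius (f c) (f c) = 0 by simp [diskMobius], sub_zero, diskMobius, norm_div,
    div_le_iff₀ h0, one_div_mul_eq_div, div_mul_eq_mul_div, le_div_iff₀ hR] at h1
  exact h1

/-- The Schwarz–Pick inequality. -/
theorem schwarz_pick {f : ℂ → ℂ} (hf : DifferentiableOn ℂ f unitDisk)
    (hm : MapsTo f unitDisk unitDisk) {z w : ℂ} (hz : z ∈ unitDisk) (hw : w ∈ unitDisk) :
    ‖f z - f w‖ * ‖1 - conj w * z‖ ≤ ‖z - w‖ * ‖1 - conj (f w) * f z‖ := by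
  have hw' : -w ∈ unitDisk := by simpa [unitDisk] using hw
  have hmm : MapsTo (diskMobius (-w)) unitDisk unitDisk := fun _ h => diskMobius_mem hw' h
  have h1 := norm_sub_mul_le_of_mapsTo_ball (f := fun z => f (diskMobius (-w) z)) (c := 0)
    (R := 1) (hf.comp (differentiableOn_diskMobius hw') hmm) (hm.comp hmm)
    (diskMobius_mem hw hz)
  simp only [diskMobius_neg_comp hw hz] at h1
  rw [show diskMobius (-w) 0 = w by simp [diskMobius], sub_zero, mul_one, diskMobius, norm_div]
    at h1
  have h0 := norm_pos_iff.mpr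
    (one_sub_conj_mul_ne_zero (mem_unitDisk.mp hz) (mem_unitDisk.mp hw).le)
  rwa [div_mul_eq_mul_div, le_div_iff₀ h0] at h1

/-- The Schwarz–Pick inequality, in terms of `1 - ρ²` for the pseudohyperbolic distance `ρ`. -/
theorem schwarz_pick_compl {f : ℂ → ℂ} (hf : DifferentiableOn ℂ f unitDisk)
    (hm : MapsTo f unitDisk unitDisk) {z w : ℂ} (hz : z ∈ unitDisk) (hw : w ∈ unitDisk) :
    (1 - ‖z‖ ^ 2) * (1 - ‖w‖ ^ 2) * ‖1 - conj (f w) * f z‖ ^ 2 ≤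
      (1 - ‖f z‖ ^ 2) * (1 - ‖f w‖ ^ 2) * ‖1 - conj w * z‖ ^ 2 := by
  have h1 := schwarz_pick hf hm hz hw
  have h2 : (‖f z - f w‖ * ‖1 - conj w * z‖) ^ 2 ≤ (‖z - w‖ * ‖1 - conj (f w) * f z‖) ^ 2 :=
    pow_le_pow_left₀ (by positivity) h1 2
  have h3 := norm_one_sub_conj_mul_sq z w
  have h4 := norm_one_sub_conj_mul_sq (f z) (f w)
  rw [mul_pow, mul_pow, h3, h4] at h2
  rw [h3, h4]
  nlinarith

theorem one_sub_norm_sq_pos {z : ℂ} (hz : z ∈ unitDisk) : 0 < 1 - ‖z‖ ^ 2 := by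
  rw [mem_unitDisk] at hz
  nlinarith [norm_nonneg z]

/-- Points at bounded pseudohyperbolic distance are at Euclidean distance comparable with the
distance to the circle. -/
theorem norm_sub_le_of_pseudohyperbolic {z w : ℂ} {r : ℝ} (hr : 0 ≤ r) (hz : z ∈ unitDisk)
    (h : ‖z - w‖ ≤ r * ‖1 - conj z * w‖) : (1 - r) * ‖z - w‖ ≤ r * (1 - ‖z‖ ^ 2) := by
  have h1 : 1 - conj z * w = ((1 - ‖z‖ ^ 2 : ℝ) : ℂ) + conj z * (z - w) := by
    have : conj z * z = ((‖z‖ ^ 2 : ℝ) : ℂ) := by rw [Complex.conj_mul']; push_cast; rfl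
    rw [mul_sub, this]; push_cast; ring
  have h2 : ‖1 - conj z * w‖ ≤ (1 - ‖z‖ ^ 2) + ‖z - w‖ := by
    rw [h1]
    refine (norm_add_le _ _).trans ?_
    rw [Complex.norm_real, Real.norm_of_nonneg (one_sub_norm_sq_pos hz).le, norm_mul,
      RCLike.norm_conj]
    have := mul_le_mul_of_nonneg_right (mem_unitDisk.mp hz).le (norm_nonneg (z - w))
    linarith
  nlinarith [mul_le_mul_of_nonneg_left h2 hr]

theorem one_sub_norm_sq_le_of_pseudohyperbolic {z w : ℂ} {r : ℝ} (hr : 0 ≤ r) (hr1 : r < 1)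
    (hz : z ∈ unitDisk) (hw : w ∈ unitDisk) (h : ‖z - w‖ ≤ r * ‖1 - conj z * w‖) :
    (1 - r) * (1 - ‖w‖ ^ 2) ≤ (1 + r) * (1 - ‖z‖ ^ 2) := by
  have h1 := norm_sub_le_of_pseudohyperbolic hr hz h
  have h2 := norm_sub_norm_le z w
  rw [mem_unitDisk] at hz hw
  have h3 : ‖z‖ ^ 2 - ‖w‖ ^ 2 ≤ 2 * ‖z - w‖ := by
    rcases le_total ‖w‖ ‖z‖ with h4 | h4
    · nlinarith [norm_nonneg z, norm_nonneg w]
    · nlinarith [norm_nonneg z, norm_nonneg w, norm_nonneg (z - w)]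
  nlinarith

/-- If `z` tends to a point of the circle and `w` stays at bounded pseudohyperbolic distance from
`z`, then `w` tends to the same point. -/
theorem tendsto_of_pseudohyperbolic {ι : Type*} {l : Filter ι} {z w : ι → ℂ} {ζ : ℂ} {r : ℝ}
    (hr : 0 ≤ r) (hr1 : r < 1) (hζ : ‖ζ‖ = 1) (hz : ∀ᶠ i in l, z i ∈ unitDisk)
    (h : ∀ᶠ i in l, ‖z i - w i‖ ≤ r * ‖1 - conj (z i) * w i‖)
    (hlim : Tendsto z l (𝓝 ζ)) : Tendsto w l (𝓝 ζ) := by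
  have h1 : Tendsto (fun i => r / (1 - r) * (1 - ‖z i‖ ^ 2)) l (𝓝 0) := by
    have : Tendsto (fun i => r / (1 - r) * (1 - ‖z i‖ ^ 2)) l
        (𝓝 (r / (1 - r) * (1 - ‖ζ‖ ^ 2))) := by
      exact (((hlim.norm).pow 2).const_sub 1).const_mul _
    simpa [hζ] using this
  have h2 : Tendsto (fun i => z i - w i) l (𝓝 0) := by
    refine squeeze_zero_norm' ?_ h1
    filter_upwards [hz, h] with i hi hi2
    rw [div_mul_eq_mul_div, le_div_iff₀ (by linarith), mul_comm]
    exact norm_sub_le_of_pseudohyperbolic hr hi hi2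
  simpa using hlim.sub h2

/-- A holomorphic self-map of the disk brings no point closer to the circle by more than a constant
factor. -/
theorem exists_mul_one_sub_norm_le {f : ℂ → ℂ} (hf : DifferentiableOn ℂ f unitDisk)
    (hm : MapsTo f unitDisk unitDisk) :
    ∃ c > 0, ∀ z ∈ unitDisk, c * (1 - ‖z‖) ≤ 1 - ‖f z‖ := by
  have h0 := hm zero_mem_unitDisk
  have h0' := one_sub_norm_sq_pos h0
  have h0'' := mem_unitDisk.mp h0
  refine ⟨(1 - ‖f 0‖) ^ 2 / 2, by have : 0 < 1 - ‖f 0‖ := by linarith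
                                  positivity, fun z hz => ?_⟩
  have h1 := schwarz_pick_compl hf hm hz zero_mem_unitDisk
  have h2 : 1 - ‖f 0‖ ≤ ‖1 - conj (f 0) * f z‖ := by
    have := norm_sub_norm_le 1 (conj (f 0) * f z)
    rw [norm_one, norm_mul, RCLike.norm_conj] at this
    nlinarith [norm_nonneg (f 0), mem_unitDisk.mp (hm hz)]
  have h3 : (1 - ‖f 0‖) ^ 2 ≤ ‖1 - conj (f 0) * f z‖ ^ 2 :=
    pow_le_pow_left₀ (by linarith) h2 2
  simp only [norm_zero, map_zero, zero_mul, sub_zero, norm_one] at h1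
  have hz' := mem_unitDisk.mp hz
  have hfz := mem_unitDisk.mp (hm hz)
  have h4 : (1 - ‖z‖ ^ 2) * ‖1 - conj (f 0) * f z‖ ^ 2 ≤ 1 - ‖f z‖ ^ 2 := by
    nlinarith [one_sub_norm_sq_pos (hm hz), sq_nonneg ‖f 0‖]
  have h5 : (1 - ‖z‖) * (1 - ‖f 0‖) ^ 2 ≤ (1 - ‖z‖ ^ 2) * ‖1 - conj (f 0) * f z‖ ^ 2 := by
    apply mul_le_mul _ h3 (by positivity) (one_sub_norm_sq_pos hz).le
    nlinarith [norm_nonneg z]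
  nlinarith [norm_nonneg (f z)]

/-- Julia's lemma: if the self-map `f` of the disk takes points tending to `σ` to points tending
to `σ` and increases the distance to the circle at most by the factor `A` along them, then it maps
each horodisk at `σ` into a horodisk at `σ`. -/
theorem julia_lemma {ι : Type*} {l : Filter ι} [l.NeBot] {f : ℂ → ℂ} {z : ι → ℂ} {σ : ℂ} {A : ℝ}
    (hf : DifferentiableOn ℂ f unitDisk) (hm : MapsTo f unitDisk unitDisk)
    (hσ : ‖σ‖ = 1) (hz : ∀ᶠ i in l, z i ∈ unitDisk) (hlim : Tendsto z l (𝓝 σ))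
    (hflim : Tendsto (fun i => f (z i)) l (𝓝 σ))
    (hA : ∀ᶠ i in l, 1 - ‖f (z i)‖ ^ 2 ≤ A * (1 - ‖z i‖ ^ 2)) {w : ℂ} (hw : w ∈ unitDisk) :
    (1 - ‖w‖ ^ 2) * ‖σ - f w‖ ^ 2 ≤ A * (1 - ‖f w‖ ^ 2) * ‖σ - w‖ ^ 2 := by
  have key : ∀ v : ℂ, ‖1 - conj σ * v‖ = ‖σ - v‖ := fun v => by
    have h1 : σ * conj σ = 1 := by rw [Complex.mul_conj']; simp [hσ]
    have h2 : σ * (1 - conj σ * v) = σ - v := by linear_combination (-v) * h1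
    rw [← h2, norm_mul, hσ, one_mul]
  rw [← key, ← key]
  have hc : Continuous (fun v : ℂ => conj v) := Complex.continuous_conj
  have t1 : Tendsto (fun i => (1 - ‖w‖ ^ 2) * ‖1 - conj (f (z i)) * f w‖ ^ 2) l
      (𝓝 ((1 - ‖w‖ ^ 2) * ‖1 - conj σ * f w‖ ^ 2)) :=
    (((((hc.tendsto σ).comp hflim).mul_const _).const_sub 1).norm.pow 2).const_mul _
  have t2 : Tendsto (fun i => A * (1 - ‖f w‖ ^ 2) * ‖1 - conj (z i) * w‖ ^ 2) l
      (𝓝 (A * (1 - ‖f w‖ ^ 2) * ‖1 - conj σ * w‖ ^ 2)) :=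
    (((((hc.tendsto σ).comp hlim).mul_const _).const_sub 1).norm.pow 2).const_mul _
  refine le_of_tendsto_of_tendsto t1 t2 ?_
  filter_upwards [hz, hA] with i hi hi2
  have h1 := schwarz_pick_compl hf hm hw hi
  have h2 := one_sub_norm_sq_pos hi
  have h3 := one_sub_norm_sq_pos (hm hw)
  have h4 : (1 - ‖f w‖ ^ 2) * (1 - ‖f (z i)‖ ^ 2) * ‖1 - conj (z i) * w‖ ^ 2 ≤
      (1 - ‖f w‖ ^ 2) * (A * (1 - ‖z i‖ ^ 2)) * ‖1 - conj (z i) * w‖ ^ 2 := by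
    gcongr
  refine le_of_mul_le_mul_left ?_ h2
  nlinarith

/-! ### Automorphisms of the disk and inverses of conformal maps -/

/-- The inverse of a conformal map is a conformal map. -/
theorem IsConformalOnto.exists_inverse {f : ℂ → ℂ} {U V : Set ℂ} (hf : IsConformalOnto f U V)
    (hU : IsOpen U) : IsOpen V ∧ ∃ g : ℂ → ℂ, IsConformalOnto g V U ∧ (∀ z ∈ U, g (f z) = z) ∧
      ∀ w ∈ V, f (g w) = w := by
  have hmap : ∀ z ∈ U, 𝓝 (f z) ≤ Filter.map f (𝓝 z) := by
    intro z hz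
    have ha : AnalyticAt ℂ f z := hf.holo.analyticAt (hU.mem_nhds hz)
    refine ha.eventually_constant_or_nhds_le_map_nhds.resolve_left fun hc => ?_
    have h1 : ∀ᶠ w in 𝓝[≠] z, f w = f z ∧ w ∈ U ∧ w ≠ z := by
      filter_upwards [hc.filter_mono nhdsWithin_le_nhds,
        (hU.mem_nhds hz : U ∈ 𝓝 z) |> mem_nhdsWithin_of_mem_nhds, self_mem_nhdsWithin]
        with w h1 h2 h3 using ⟨h1, h2, h3⟩
    obtain ⟨w, h1, h2, h3⟩ := h1.exists
    exact h3 (hf.inj h2 hz h1)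
  have hopen : ∀ W ⊆ U, IsOpen W → IsOpen (f '' W) := by
    intro W hWU hW
    rw [isOpen_iff_mem_nhds]
    rintro _ ⟨z, hz, rfl⟩
    exact hmap z (hWU hz) (image_mem_map (hW.mem_nhds hz))
  have hV : IsOpen V := hf.image_eq ▸ hopen U subset_rfl hU
  refine ⟨hV, ?_⟩
  let g := Function.invFunOn f U
  have hgU : ∀ w ∈ V, g w ∈ U := fun w hw =>
    Function.invFunOn_mem (by rw [← hf.image_eq] at hw; exact hw)
  have hfg : ∀ w ∈ V, f (g w) = w := fun w hw =>
    Function.invFunOn_eq (by rw [← hf.image_eq] at hw; exact hw)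
  have hgf : ∀ z ∈ U, g (f z) = z := fun z hz =>
    hf.inj (hgU _ (hf.image_eq ▸ mem_image_of_mem f hz)) hz
      (hfg _ (hf.image_eq ▸ mem_image_of_mem f hz))
  have hfV : ∀ z ∈ U, f z ∈ V := fun z hz => hf.image_eq ▸ mem_image_of_mem f hz
  have hcont : ∀ w ∈ V, ContinuousAt g w := by
    intro w hw
    have h1 : Tendsto g (Filter.map f (𝓝 (g w))) (𝓝 (g w)) := by
      rw [tendsto_map'_iff]
      refine tendsto_id.congr' ?_
      filter_upwards [hU.mem_nhds (hgU w hw)] with z hz using (hgf z hz).symm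
    have h2 := hmap (g w) (hgU w hw)
    rw [hfg w hw] at h2
    exact h1.mono_left h2
  have hdiff0 : ∀ w ∈ V, deriv f (g w) ≠ 0 → DifferentiableAt ℂ g w := by
    intro w hw hd
    have h1 : HasDerivAt f (deriv f (g w)) (g w) :=
      (hf.holo.differentiableAt (hU.mem_nhds (hgU w hw))).hasDerivAt
    refine (HasDerivAt.of_local_left_inverse (hcont w hw) h1 hd ?_).differentiableAt
    filter_upwards [hV.mem_nhds hw] with v hv using hfg v hv
  have hdiff : ∀ w ∈ V, DifferentiableAt ℂ g w := by
    intro w hw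
    -- zeros of `deriv f` are isolated, and isolated singularities of the continuous map `g`
    -- are removable
    have ha : AnalyticAt ℂ (deriv f) (g w) := (hf.holo.analyticAt (hU.mem_nhds (hgU w hw))).deriv
    refine (Complex.analyticAt_of_differentiable_on_punctured_nhds_of_continuousAt ?_
      (hcont w hw)).differentiableAt
    rcases ha.eventually_eq_zero_or_eventually_ne_zero with h0 | h0
    · exfalso
      have h1 : ∀ᶠ z in 𝓝 (g w), f z = f (g w) := by
        obtain ⟨r, hr, hr2⟩ := Metric.eventually_nhds_iff_ball.mp
          (h0.and (hU.mem_nhds (hgU w hw)))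
        refine Metric.eventually_nhds_iff_ball.mpr ⟨r, hr, fun z hz => ?_⟩
        exact (convex_ball (g w) r).is_const_of_fderivWithin_eq_zero (𝕜 := ℂ)
          (f := f) (fun v hv => (hf.holo.differentiableAt
            (hU.mem_nhds (hr2 v hv).2)).differentiableWithinAt) (fun v hv => by
              rw [fderivWithin_of_isOpen Metric.isOpen_ball hv]
              ext
              simp [(hr2 v hv).1]) hz (Metric.mem_ball_self hr)
      have h2 : ∀ᶠ z in 𝓝[≠] (g w), z ≠ g w ∧ z ∈ U ∧ f z = f (g w) := by
        filter_upwards [h1.filter_mono nhdsWithin_le_nhds, self_mem_nhdsWithin,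
          mem_nhdsWithin_of_mem_nhds (hU.mem_nhds (hgU w hw))] with z a b c using ⟨b, c, a⟩
      obtain ⟨z, h3, h4, h5⟩ := h2.exists
      exact h3 (hf.inj h4 (hgU w hw) h5)
    · have h1 : Tendsto g (𝓝[≠] w) (𝓝[≠] (g w)) := by
        refine tendsto_nhdsWithin_iff.mpr ⟨(hcont w hw).mono_left nhdsWithin_le_nhds, ?_⟩
        filter_upwards [self_mem_nhdsWithin, mem_nhdsWithin_of_mem_nhds (hV.mem_nhds hw)]
          with v hv hvV hgv
        apply hv
        rw [mem_singleton_iff] at hgv ⊢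
        rw [← hfg v hvV, hgv, hfg w hw]
      filter_upwards [h1.eventually h0, mem_nhdsWithin_of_mem_nhds (hV.mem_nhds hw)]
        with v hv hvV using hdiff0 v hvV hv
  refine ⟨g, ⟨fun w hw => (hdiff w hw).differentiableWithinAt, ?_, ?_⟩, hgf, hfg⟩
  · intro v hv w hw hvw
    rw [← hfg v hv, hvw, hfg w hw]
  · ext z
    constructor
    · rintro ⟨w, hw, rfl⟩; exact hgU w hw
    · intro hz; exact ⟨f z, hfV z hz, hgf z hz⟩

theorem IsConformalOnto.mapsTo {f : ℂ → ℂ} {U V : Set ℂ} (hf : IsConformalOnto f U V) :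
    MapsTo f U V := fun _ hz => hf.image_eq ▸ mem_image_of_mem f hz

theorem IsConformalOnto.comp {f g : ℂ → ℂ} {U V W : Set ℂ} (hg : IsConformalOnto g V W)
    (hf : IsConformalOnto f U V) : IsConformalOnto (fun z => g (f z)) U W :=
  ⟨hg.holo.comp hf.holo hf.mapsTo, hg.inj.comp hf.inj hf.mapsTo, by
    rw [← hg.image_eq, ← hf.image_eq, image_image]⟩

/-- An automorphism of the disk is a rotation followed by a Möbius map. -/
theorem IsConformalOnto.exists_eq_diskMobius {j : ℂ → ℂ}
    (hj : IsConformalOnto j unitDisk unitDisk) :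
    ∃ α ∈ unitDisk, ∃ c : ℂ, ‖c‖ = 1 ∧ ∀ z ∈ unitDisk, j z = c * diskMobius α z := by
  obtain ⟨-, k, hk, hkj, hjk⟩ := hj.exists_inverse isOpen_unitDisk
  set α := k 0 with hα
  have hαD : α ∈ unitDisk := hk.mapsTo zero_mem_unitDisk
  have hαD' : -α ∈ unitDisk := by simpa [unitDisk] using hαD
  have hT : MapsTo (diskMobius (-α)) unitDisk unitDisk := fun _ h => diskMobius_mem hαD' h
  have hT2 : MapsTo (diskMobius α) unitDisk unitDisk := fun _ h => diskMobius_mem hαD h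
  have hd : DifferentiableOn ℂ (fun z => j (diskMobius (-α) z)) unitDisk :=
    hj.holo.comp (differentiableOn_diskMobius hαD') hT
  have hd2 : DifferentiableOn ℂ (fun z => diskMobius α (k z)) unitDisk :=
    (differentiableOn_diskMobius hαD).comp hk.holo hk.mapsTo
  have h00 : j (diskMobius (-α) 0) = 0 := by
    rw [show diskMobius (-α) 0 = α by simp [diskMobius], hα]
    exact hjk 0 zero_mem_unitDisk
  have hn : ∀ z ∈ unitDisk, ‖j (diskMobius (-α) z)‖ = ‖z‖ := by
    intro z hz
    apply le_antisymm
    · exact Complex.norm_le_norm_of_mapsTo_ball (f := fun z => j (diskMobius (-α) z)) hd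
        (fun w hw => Metric.ball_subset_closedBall (hj.mapsTo (hT hw))) h00 (mem_unitDisk.mp hz)
    · have h1 := Complex.norm_le_norm_of_mapsTo_ball (f := fun z => diskMobius α (k z)) hd2
        (fun w hw => Metric.ball_subset_closedBall (hT2 (hk.mapsTo hw)))
        (by simp [diskMobius, hα]) (mem_unitDisk.mp (hj.mapsTo (hT hz)))
      simpa only [hkj _ (hT hz), diskMobius_comp_neg hαD hz] using h1
  obtain ⟨C, hC, hE⟩ := Complex.affine_of_mapsTo_ball_of_exists_norm_dslope_eq_div'
    (f := fun z => j (diskMobius (-α) z)) (c := 0) (R₁ := 1) (R₂ := 1) hd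
    (fun w hw => by
      rw [h00]; exact Metric.ball_subset_closedBall (hj.mapsTo (hT hw)))
    ⟨1 / 2, by norm_num, by
      rw [dslope_of_ne _ (by norm_num), slope_def_field, h00, norm_div, sub_zero, sub_zero,
        hn (1 / 2) (by norm_num [unitDisk])]
      norm_num⟩
  refine ⟨α, hαD, C, by simpa using hC, fun z hz => ?_⟩
  have := hE (diskMobius_mem hαD hz)
  simp only [h00, diskMobius_neg_comp hαD hz, sub_zero, zero_add, smul_eq_mul] at this
  rw [this, mul_comm]

theorem norm_diskMobius_of_norm_eq_one {α z : ℂ} (hα : α ∈ unitDisk) (hz : ‖z‖ = 1) :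
    ‖diskMobius α z‖ = 1 := by
  have h1 := norm_one_sub_conj_mul_sq z α
  rw [hz] at h1
  have h2 : ‖1 - conj α * z‖ = ‖z - α‖ := by
    rw [← sq_eq_sq₀ (norm_nonneg _) (norm_nonneg _)]; linarith
  rw [diskMobius, norm_div, h2, div_self]
  rw [norm_ne_zero_iff, sub_ne_zero]
  rintro rfl
  rw [mem_unitDisk] at hα
  linarith

/-- An automorphism of the disk extends differentiably to the boundary point `1`, and maps it to
the circle. -/
theorem IsConformalOnto.exists_boundary_value {j : ℂ → ℂ}
    (hj : IsConformalOnto j unitDisk unitDisk) :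
    ∃ κ d : ℂ, ‖κ‖ = 1 ∧ Tendsto j (𝓝[unitDisk] 1) (𝓝 κ) ∧
      Tendsto (fun z => (j z - κ) / (z - 1)) (𝓝[unitDisk] 1) (𝓝 d) := by
  obtain ⟨α, hα, c, hc, h⟩ := hj.exists_eq_diskMobius
  have hd : DifferentiableAt ℂ (fun z => c * diskMobius α z) 1 :=
    (differentiableAt_diskMobius hα (by simp)).const_mul c
  have hev : ∀ᶠ z in 𝓝[unitDisk] (1 : ℂ), j z = c * diskMobius α z := by
    filter_upwards [self_mem_nhdsWithin] with z hz using h z hz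
  refine ⟨c * diskMobius α 1, deriv (fun z => c * diskMobius α z) 1, ?_, ?_, ?_⟩
  · rw [norm_mul, hc, norm_diskMobius_of_norm_eq_one hα (by simp), one_mul]
  · refine Tendsto.congr' (hev.mono fun z hz => hz.symm) ?_
    exact hd.continuousAt.mono_left nhdsWithin_le_nhds
  · have h1 := hasDerivAt_iff_tendsto_slope.mp hd.hasDerivAt
    have h2 : 𝓝[unitDisk] (1 : ℂ) ≤ 𝓝[≠] 1 := by
      apply nhdsWithin_mono
      rintro z hz rfl
      simp [unitDisk] at hz
    refine (h1.mono_left h2).congr' ?_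
    filter_upwards [hev] with z hz
    rw [slope_def_field, hz]

/-! ### Petals and strips in the Koenigs domain -/

/-- `k` is the inverse of the Koenigs function `h`, defined on the Koenigs domain. -/
structure IsKoenigsInverse (h k : ℂ → ℂ) : Prop where
  conformal : IsConformalOnto k (h '' unitDisk) unitDisk
  left : ∀ z ∈ unitDisk, k (h z) = z
  right : ∀ w ∈ h '' unitDisk, h (k w) = w
  isOpen : IsOpen (h '' unitDisk)

theorem IsKoenigsFunction.isConformalOnto {φ : ℝ → ℂ → ℂ} {h : ℂ → ℂ}
    (hh : IsKoenigsFunction φ h) : IsConformalOnto h unitDisk (h '' unitDisk) :=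
  ⟨hh.holo, hh.inj, rfl⟩

theorem IsKoenigsFunction.exists_inverse {φ : ℝ → ℂ → ℂ} {h : ℂ → ℂ}
    (hh : IsKoenigsFunction φ h) : ∃ k, IsKoenigsInverse h k := by
  obtain ⟨ho, k, hk, h1, h2⟩ := hh.isConformalOnto.exists_inverse isOpen_unitDisk
  exact ⟨k, hk, h1, h2, ho⟩

section Koenigs

variable {φ : ℝ → ℂ → ℂ} {h k : ℂ → ℂ} {Δ : Set ℂ} {σ : ℂ}

theorem IsKoenigsFunction.add_mem (hφ : IsOneParameterSemigroup φ) (hh : IsKoenigsFunction φ h)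
    {w : ℂ} (hw : w ∈ h '' unitDisk) {t : ℝ} (ht : 0 ≤ t) : w + t ∈ h '' unitDisk := by
  obtain ⟨z, hz, rfl⟩ := hw
  exact ⟨φ t z, hφ.mapsTo t ht hz, hh.abel t ht z hz⟩

theorem IsKoenigsInverse.semigroup_apply (hφ : IsOneParameterSemigroup φ)
    (hh : IsKoenigsFunction φ h) (hk : IsKoenigsInverse h k)
    {w : ℂ} (hw : w ∈ h '' unitDisk) {t : ℝ} (ht : 0 ≤ t) : φ t (k w) = k (w + t) := by
  have hkw := hk.conformal.mapsTo hw
  rw [← hk.left _ (hφ.mapsTo t ht hkw), hh.abel t ht _ hkw, hk.right w hw]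

/-- The heights of the horizontal lines contained in `Ω`. -/
def lineHeights (Ω : Set ℂ) : Set ℝ := {y | ∀ w : ℂ, w.im = y → w ∈ Ω}

theorem mem_backwardInvariantSet_iff (hφ : IsOneParameterSemigroup φ)
    (hh : IsKoenigsFunction φ h) {z : ℂ} :
    z ∈ backwardInvariantSet φ ↔ z ∈ unitDisk ∧ (h z).im ∈ lineHeights (h '' unitDisk) := by
  simp only [backwardInvariantSet, mem_iInter, mem_Ici]
  constructor
  · intro H
    have hz : z ∈ unitDisk := by
      obtain ⟨v, hv, hvz⟩ := H 0 le_rfl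
      rw [hφ.zero v hv] at hvz
      exact hvz ▸ hv
    refine ⟨hz, fun w hw => ?_⟩
    obtain ⟨r, hr⟩ : ∃ r : ℝ, w = h z + r :=
      ⟨w.re - (h z).re, by apply Complex.ext <;> simp [hw]⟩
    rcases le_total 0 r with h2 | h2
    · rw [hr]
      exact IsKoenigsFunction.add_mem hφ hh (mem_image_of_mem h hz) h2
    · obtain ⟨v, hv, hvz⟩ := H (-r) (by linarith)
      refine ⟨v, hv, ?_⟩
      have h3 := hh.abel (-r) (by linarith) v hv
      rw [hvz] at h3
      rw [hr, h3]
      push_cast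
      ring
  · rintro ⟨hz, hy⟩ t ht
    obtain ⟨v, hv, hvz⟩ := hy (h z - t) (by simp)
    refine ⟨v, hv, hh.inj (hφ.mapsTo t ht hv) hz ?_⟩
    rw [hh.abel t ht v hv, hvz]
    ring

theorem mem_interior_backwardInvariantSet_iff (hφ : IsOneParameterSemigroup φ)
    (hh : IsKoenigsFunction φ h) (hk : IsKoenigsInverse h k) {z : ℂ} :
    z ∈ interior (backwardInvariantSet φ) ↔
      z ∈ unitDisk ∧ (h z).im ∈ interior (lineHeights (h '' unitDisk)) := by
  constructor
  · intro hz
    have hzD := ((mem_backwardInvariantSet_iff hφ hh).mp (interior_subset hz)).1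
    refine ⟨hzD, ?_⟩
    -- near `h z`, the inverse of `h` stays in the interior of the backward invariant set
    have hkc : ContinuousAt k (h z) := hk.conformal.holo.continuousOn.continuousAt
      (hk.isOpen.mem_nhds (mem_image_of_mem h hzD))
    have h1 : ∀ᶠ w in 𝓝 (h z), w.im ∈ lineHeights (h '' unitDisk) := by
      have h2 : ∀ᶠ w in 𝓝 (h z), k w ∈ interior (backwardInvariantSet φ) := by
        refine hkc.eventually_mem ?_
        rw [hk.left z hzD]
        exact isOpen_interior.mem_nhds hz
      filter_upwards [h2, hk.isOpen.mem_nhds (mem_image_of_mem h hzD)] with w hw hw2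
      have := ((mem_backwardInvariantSet_iff hφ hh).mp (interior_subset hw)).2
      rwa [hk.right w hw2] at this
    have h3 : Tendsto (fun y : ℝ => ((h z).re : ℂ) + y * Complex.I) (𝓝 (h z).im) (𝓝 (h z)) := by
      have : Continuous (fun y : ℝ => ((h z).re : ℂ) + y * Complex.I) := by fun_prop
      simpa using this.tendsto (h z).im
    rw [mem_interior_iff_mem_nhds]
    filter_upwards [h3.eventually h1] with y hy
    simpa using hy
  · rintro ⟨hzD, hy⟩
    rw [mem_interior_iff_mem_nhds]
    have hhc : ContinuousAt h z :=
      hh.holo.continuousOn.continuousAt (isOpen_unitDisk.mem_nhds hzD)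
    filter_upwards [isOpen_unitDisk.mem_nhds hzD,
      (Complex.continuous_im.continuousAt.comp hhc).eventually_mem
        (isOpen_interior.mem_nhds hy)] with v hv hv2
    exact (mem_backwardInvariantSet_iff hφ hh).mpr ⟨hv, interior_subset hv2⟩

/-- The image of a petal under the Koenigs function is the union of the horizontal lines at the
heights in a connected component of the interior of `lineHeights`. -/
theorem IsPetal.exists_image_eq (hφ : IsOneParameterSemigroup φ) (hh : IsKoenigsFunction φ h)
    (hΔ : IsPetal φ Δ) :
    Δ ⊆ unitDisk ∧ ∃ y₀ ∈ interior (lineHeights (h '' unitDisk)),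
      h '' Δ = {w | w.im ∈ connectedComponentIn (interior (lineHeights (h '' unitDisk))) y₀} := by
  obtain ⟨k, hk⟩ := hh.exists_inverse
  obtain ⟨z, hz, rfl⟩ := hΔ
  set W := interior (backwardInvariantSet φ) with hW
  set Y := interior (lineHeights (h '' unitDisk)) with hY
  have hmem : ∀ {v}, v ∈ W ↔ v ∈ unitDisk ∧ (h v).im ∈ Y := fun {v} =>
    mem_interior_backwardInvariantSet_iff hφ hh hk
  have hsub : connectedComponentIn W z ⊆ W := connectedComponentIn_subset W z
  have hΔD : connectedComponentIn W z ⊆ unitDisk := fun v hv => (hmem.mp (hsub hv)).1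
  refine ⟨hΔD, (h z).im, (hmem.mp hz).2, ?_⟩
  apply Subset.antisymm
  · rintro _ ⟨v, hv, rfl⟩
    have h1 : IsPreconnected ((fun v => (h v).im) '' connectedComponentIn W z) :=
      isPreconnected_connectedComponentIn.image _
        (Complex.continuous_im.comp_continuousOn (hh.holo.continuousOn.mono hΔD))
    refine h1.subset_connectedComponentIn (mem_image_of_mem _ (mem_connectedComponentIn hz)) ?_
      (mem_image_of_mem _ hv)
    rintro _ ⟨u, hu, rfl⟩
    exact (hmem.mp (hsub hu)).2
  · set J := connectedComponentIn Y (h z).im with hJ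
    have hJY : J ⊆ Y := connectedComponentIn_subset Y _
    have hsubΩ : {w : ℂ | w.im ∈ J} ⊆ h '' unitDisk := fun w hw =>
      interior_subset (hJY hw) w rfl
    have hconv : IsPreconnected {w : ℂ | w.im ∈ J} := by
      have h1 : Convex ℝ J :=
        isPreconnected_connectedComponentIn.ordConnected.convex
      exact (h1.linear_preimage Complex.imLm).isPreconnected
    have h2 : IsPreconnected (k '' {w : ℂ | w.im ∈ J}) :=
      hconv.image _ (hk.conformal.holo.continuousOn.mono hsubΩ)
    intro w hw
    refine ⟨k w, ?_, hk.right w (hsubΩ hw)⟩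
    refine h2.subset_connectedComponentIn ⟨h z, mem_connectedComponentIn (hmem.mp hz).2,
      hk.left z (hmem.mp hz).1⟩ ?_ (mem_image_of_mem _ hw)
    rintro _ ⟨u, hu, rfl⟩
    refine hmem.mpr ⟨hk.conformal.mapsTo (hsubΩ hu), ?_⟩
    rw [hk.right u (hsubΩ hu)]
    exact hJY hu

/-! ### Backward orbits and the growth of the Poisson kernel at the `α`-point -/

theorem IsKoenigsInverse.isBackwardOrbit (hφ : IsOneParameterSemigroup φ)
    (hh : IsKoenigsFunction φ h) (hk : IsKoenigsInverse h k) {w : ℂ}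
    (hw : ∀ t : ℝ, 0 ≤ t → w - t ∈ h '' unitDisk) :
    IsBackwardOrbit φ (fun t => k (w - t)) := by
  refine ⟨fun t ht => hk.conformal.mapsTo (hw t ht), ?_, ?_⟩
  · refine hk.conformal.holo.continuousOn.comp (t := h '' unitDisk) ?_ fun t ht => hw t ht
    fun_prop
  · intro t ht s hs
    rw [hk.semigroup_apply hφ hh (hw t ht.le) hs.1.le]
    congr 1
    push_cast
    ring

/-- In the Koenigs coordinate, backward orbits starting in the petal move to the left and tend to
the `α`-point. -/
theorem IsAlphaPoint.tendsto (hφ : IsOneParameterSemigroup φ) (hh : IsKoenigsFunction φ h)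
    (hk : IsKoenigsInverse h k) (hΔD : Δ ⊆ unitDisk) (hσ : IsAlphaPoint φ Δ σ) {w : ℂ}
    (hwΔ : w ∈ h '' Δ) (hw : ∀ t : ℝ, 0 ≤ t → w - t ∈ h '' unitDisk) :
    Tendsto (fun t : ℝ => k (w - t)) atTop (𝓝 σ) := by
  refine hσ _ (hk.isBackwardOrbit hφ hh hw) ?_
  obtain ⟨z, hz, rfl⟩ := hwΔ
  simpa [hk.left z (hΔD hz)] using hz

/-- A limit of a backward orbit lies on the unit circle: the Koenigs function is unbounded along
the orbit. -/
theorem IsKoenigsInverse.norm_eq_one_of_tendsto (hh : IsKoenigsFunction φ h)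
    (hk : IsKoenigsInverse h k) {w : ℂ} (hw : ∀ t : ℝ, 0 ≤ t → w - t ∈ h '' unitDisk)
    (hlim : Tendsto (fun t : ℝ => k (w - t)) atTop (𝓝 σ)) : ‖σ‖ = 1 := by
  have hev : ∀ᶠ t : ℝ in atTop, w - t ∈ h '' unitDisk := by
    filter_upwards [eventually_ge_atTop 0] with t ht using hw t ht
  apply le_antisymm
  · refine le_of_tendsto hlim.norm ?_
    filter_upwards [hev] with t ht using (mem_unitDisk.mp (hk.conformal.mapsTo ht)).le
  · by_contra! hlt
    have hc : ContinuousAt h σ :=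
      hh.holo.continuousOn.continuousAt (isOpen_unitDisk.mem_nhds (mem_unitDisk.mpr hlt))
    have h1 : Tendsto (fun t : ℝ => w - t) atTop (𝓝 (h σ)) := by
      refine (hc.tendsto.comp hlim).congr' ?_
      filter_upwards [hev] with t ht using hk.right _ ht
    have h2 : Tendsto (fun t : ℝ => (w - t).re) atTop (𝓝 (h σ).re) :=
      (Complex.continuous_re.tendsto _).comp h1
    have h3 : Tendsto (fun t : ℝ => (w - t).re) atTop atBot := by
      simp only [Complex.sub_re, Complex.ofReal_re]
      simp only [sub_eq_add_neg]
      exact tendsto_atBot_add_const_left _ _ tendsto_neg_atTop_atBot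
    exact not_tendsto_nhds_of_tendsto_atBot h3 _ h2

/-- If the disks of radius `R` centred at `w₀ - s`, `s ≥ 0`, lie in the Koenigs domain, then
one has a quantitative Julia inequality at the `α`-point for `φ t` with `t < R`:
along the backward orbit the hyperbolic step of `φ t` is controlled by `t / R`. -/
theorem julia_semigroup (hφ : IsOneParameterSemigroup φ)
    (hh : IsKoenigsFunction φ h) (hk : IsKoenigsInverse h k) {w₀ : ℂ} {R t : ℝ}
    (hlim : Tendsto (fun t : ℝ => k (w₀ - t)) atTop (𝓝 σ))
    (hball : ∀ s : ℝ, 0 ≤ s → Metric.ball (w₀ - s) R ⊆ h '' unitDisk)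
    (ht : 0 ≤ t) (htR : t < R) {z : ℂ} (hz : z ∈ unitDisk) :
    (1 - ‖z‖ ^ 2) * ‖σ - φ t z‖ ^ 2 ≤
      (1 + t / R) / (1 - t / R) * (1 - ‖φ t z‖ ^ 2) * ‖σ - z‖ ^ 2 := by
  have hR : 0 < R := ht.trans_lt htR
  have hr1 : t / R < 1 := (div_lt_one hR).mpr htR
  have hr0 : 0 ≤ t / R := by positivity
  have hmem : ∀ s : ℝ, 0 ≤ s → w₀ - s ∈ h '' unitDisk := fun s hs =>
    hball s hs (Metric.mem_ball_self hR)
  have hσ1 := hk.norm_eq_one_of_tendsto hh hmem hlim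
  refine julia_lemma (l := atTop) (z := fun s : ℝ => k (w₀ - s)) (hφ.holo t ht) (hφ.mapsTo t ht)
    hσ1 ?_ hlim ?_ ?_ hz
  · filter_upwards [eventually_ge_atTop 0] with s hs using hk.conformal.mapsTo (hmem s hs)
  · have h1 : Tendsto (fun s : ℝ => s - t) atTop atTop :=
      tendsto_atTop_add_const_right _ _ tendsto_id
    refine (hlim.comp h1).congr' ?_
    filter_upwards [eventually_ge_atTop 0] with s hs
    rw [hk.semigroup_apply hφ hh (hmem s hs) ht]
    simp only [Function.comp]
    congr 1
    push_cast
    ring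
  · filter_upwards [eventually_ge_atTop 0] with s hs
    have hin : w₀ - s + t ∈ Metric.ball (w₀ - s) R := by
      rw [mem_ball_iff_norm, add_sub_cancel_left, Complex.norm_real, Real.norm_of_nonneg ht]
      exact htR
    have h1 := norm_sub_mul_le_of_mapsTo_ball (hk.conformal.holo.mono (hball s hs))
      (fun v hv => hk.conformal.mapsTo (hball s hs hv)) hin
    rw [add_sub_cancel_left, Complex.norm_real, Real.norm_of_nonneg ht] at h1
    have h2 : ‖k (w₀ - s) - k (w₀ - s + t)‖ ≤
        t / R * ‖1 - conj (k (w₀ - s)) * k (w₀ - s + t)‖ := by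
      rw [norm_sub_rev, div_mul_eq_mul_div, le_div_iff₀ hR]
      exact h1
    have h3 := one_sub_norm_sq_le_of_pseudohyperbolic hr0 hr1
      (hk.conformal.mapsTo (hmem s hs)) (hk.conformal.mapsTo (hball s hs hin)) h2
    rw [hk.semigroup_apply hφ hh (hmem s hs) ht, div_mul_eq_mul_div, le_div_iff₀ (by linarith),
      mul_comm]
    exact h3

/-- If the image of the petal contains strips of arbitrarily large width, then the horodisks at
the `α`-point are invariant, so that the `α`-point is the Denjoy–Wolff point. -/
theorem alphaPoint_eq_of_unbounded (hφ : IsOneParameterSemigroup φ)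
    (hh : IsKoenigsFunction φ h) (hk : IsKoenigsInverse h k) (hΔD : Δ ⊆ unitDisk)
    (hσ : IsAlphaPoint φ Δ σ) {τ : ℂ} (hτ1 : ‖τ‖ = 1) (hτ : IsDenjoyWolffPoint φ τ)
    (hwide : ∀ R : ℝ, 0 < R → ∃ y : ℝ, ∀ w : ℂ, |w.im - y| < R → w ∈ h '' Δ) : σ = τ := by
  have hsub : h '' Δ ⊆ h '' unitDisk := image_mono hΔD
  -- the limit `R → ∞` of the quantitative Julia inequality
  have key : ∀ t : ℝ, 0 ≤ t → ∀ z ∈ unitDisk,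
      (1 - ‖z‖ ^ 2) * ‖σ - φ t z‖ ^ 2 ≤ (1 - ‖φ t z‖ ^ 2) * ‖σ - z‖ ^ 2 := by
    intro t ht z hz
    have h1 : Tendsto (fun R : ℝ => (1 + t / R) / (1 - t / R) * (1 - ‖φ t z‖ ^ 2) * ‖σ - z‖ ^ 2)
        atTop (𝓝 ((1 + 0) / (1 - 0) * (1 - ‖φ t z‖ ^ 2) * ‖σ - z‖ ^ 2)) := by
      have h0 : Tendsto (fun R : ℝ => t / R) atTop (𝓝 0) := tendsto_const_nhds.div_atTop tendsto_id
      exact ((((h0.const_add 1).div (h0.const_sub 1) (by norm_num)).mul_const _).mul_const _)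
    rw [add_zero, sub_zero, div_one, one_mul] at h1
    refine ge_of_tendsto h1 ?_
    filter_upwards [eventually_gt_atTop t] with R hR
    obtain ⟨y, hy⟩ := hwide R (ht.trans_lt hR)
    have hline : ∀ w : ℂ, w.im = y → w ∈ h '' Δ := fun w hw => hy w (by
      rw [hw, sub_self, abs_zero]; exact ht.trans_lt hR)
    have hlim := hσ.tendsto hφ hh hk hΔD (w := y * Complex.I) (hline _ (by simp))
      (fun s _ => hsub (hline _ (by simp)))
    refine julia_semigroup hφ hh hk hlim (fun s _ w hw => hsub (hy w ?_)) ht hR hz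
    rw [mem_ball_iff_norm] at hw
    refine (Eq.trans_le ?_ (Complex.abs_im_le_norm _)).trans_lt hw
    simp
  have h0 := zero_mem_unitDisk
  have h1 : (1 - ‖(0 : ℂ)‖ ^ 2) * ‖σ - τ‖ ^ 2 ≤ (1 - ‖τ‖ ^ 2) * ‖σ - 0‖ ^ 2 := by
    have hl := hτ.2 0 h0
    refine le_of_tendsto_of_tendsto (((hl.const_sub σ).norm.pow 2).const_mul _)
      (((hl.norm.pow 2).const_sub 1).mul_const _) ?_
    filter_upwards [eventually_ge_atTop 0] with t ht using key t ht 0 h0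
  rw [hτ1] at h1
  have h2 : ‖σ - τ‖ ^ 2 ≤ 0 := by simpa using h1
  have h3 : ‖σ - τ‖ = 0 := by nlinarith [norm_nonneg (σ - τ)]
  exact sub_eq_zero.mp (norm_eq_zero.mp h3)

/-- The Koenigs function maps a hyperbolic petal onto a maximal strip. -/
theorem IsHyperbolicPetal.exists_image_eq_hstrip (hφ : IsOneParameterSemigroup φ)
    (hell : IsNonElliptic φ) (hh : IsKoenigsFunction φ h) (hΔ : IsHyperbolicPetal φ Δ σ) :
    Δ ⊆ unitDisk ∧ ∃ a b : ℝ, IsMaximalStrip (h '' unitDisk) a b ∧ h '' Δ = hstrip a b := by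
  obtain ⟨k, hk⟩ := hh.exists_inverse
  obtain ⟨hΔD, y₀, hy₀, himg⟩ := hΔ.petal.exists_image_eq hφ hh
  refine ⟨hΔD, ?_⟩
  set Y := interior (lineHeights (h '' unitDisk)) with hY
  set J := connectedComponentIn Y y₀ with hJ
  have hJo : IsOpen J := isOpen_interior.connectedComponentIn
  have hJc : IsPreconnected J := isPreconnected_connectedComponentIn
  have hy₀J : y₀ ∈ J := mem_connectedComponentIn hy₀
  obtain ⟨τ, hτ1, hτ⟩ := hell
  have hne : ¬ ∀ R : ℝ, 0 < R → ∃ y : ℝ, Ioo (y - R) (y + R) ⊆ J := by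
    intro hwide
    have : σ = τ := by
      refine alphaPoint_eq_of_unbounded hφ hh hk hΔD hΔ.alpha (by simpa using hτ1) hτ ?_
      intro R hR
      obtain ⟨y, hy⟩ := hwide R hR
      refine ⟨y, fun w hw => ?_⟩
      rw [himg]
      rw [abs_lt] at hw
      exact hy ⟨by linarith, by linarith⟩
    exact hΔ.ne_dw (this ▸ hτ)
  have hbdA : BddAbove J := by
    by_contra hb
    refine hne fun R hR => ⟨y₀ + R, fun y hy => ?_⟩
    obtain ⟨y', hy', hlt⟩ := not_bddAbove_iff.mp hb y
    exact hJc.ordConnected.out hy₀J hy' ⟨by linarith [hy.1], hlt.le⟩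
  have hbdB : BddBelow J := by
    by_contra hb
    refine hne fun R hR => ⟨y₀ - R, fun y hy => ?_⟩
    obtain ⟨y', hy', hlt⟩ := not_bddBelow_iff.mp hb y
    exact hJc.ordConnected.out hy' hy₀J ⟨hlt.le, by linarith [hy.2]⟩
  have hJI : J = Ioo (sInf J) (sSup J) := by
    apply Subset.antisymm
    · intro y hy
      obtain ⟨l, u, hlu, hI⟩ := mem_nhds_iff_exists_Ioo_subset.mp (hJo.mem_nhds hy)
      constructor
      · obtain ⟨v, hv1, hv2⟩ := exists_between hlu.1
        exact (csInf_le hbdB (hI ⟨hv1, hv2.trans hlu.2⟩)).trans_lt hv2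
      · obtain ⟨v, hv1, hv2⟩ := exists_between hlu.2
        exact hv1.trans_le (le_csSup hbdA (hI ⟨hlu.1.trans hv1, hv2⟩))
    · exact IsConnected.Ioo_csInf_csSup_subset ⟨⟨y₀, hy₀J⟩, hJc⟩ hbdB hbdA
  set a := sInf J
  set b := sSup J
  have hab : y₀ ∈ Ioo a b := hJI ▸ hy₀J
  have himg' : h '' Δ = hstrip a b := by
    rw [himg, hJI]; rfl
  refine ⟨a, b, ⟨hab.1.trans hab.2, himg' ▸ image_mono hΔD, ?_⟩, himg'⟩
  intro a' b' _ hs1 hs2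
  have h1 : Ioo a' b' ⊆ J := by
    refine isPreconnected_Ioo.subset_connectedComponentIn ?_ ?_
    · have : (y₀ * Complex.I : ℂ) ∈ hstrip a' b' := hs1 (by simpa [hstrip] using hab)
      simpa [hstrip] using this
    · refine interior_maximal (fun y hy w hw => hs2 ?_) isOpen_Ioo
      rw [← hw] at hy
      exact hy
  have h2 : Ioo a b ⊆ Ioo a' b' := by
    intro y hy
    have : (y * Complex.I : ℂ) ∈ hstrip a' b' := hs1 (by simpa [hstrip] using hy)
    simpa [hstrip] using this
  rw [hJI] at h1
  have h3 := h2.antisymm h1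
  have hlt : a < b := hab.1.trans hab.2
  have hlt' : a' < b' := by
    have : y₀ ∈ Ioo a' b' := h2 hab
    exact this.1.trans this.2
  constructor
  · rw [← csInf_Ioo hlt, h3, csInf_Ioo hlt']
  · rw [← csSup_Ioo hlt, h3, csSup_Ioo hlt']

end Koenigs

/-! ### The conformal map of the disk onto a strip -/

/-- The exponential map of the strip `hstrip a b` onto the upper half-plane, which sends `-∞`
to `0`. -/
noncomputable def stripExp (a b : ℝ) (w : ℂ) : ℂ :=
  Complex.exp ((Real.pi / (b - a) : ℝ) * (w - a * Complex.I))

/-- The conformal map of the disk onto the strip `hstrip a b` which sends `1` to `-∞` and `-1`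
to `+∞`. -/
noncomputable def stripMap (a b : ℝ) (ζ : ℂ) : ℂ :=
  a * Complex.I + ((b - a) / Real.pi : ℝ) * Complex.log (Complex.I * ((1 - ζ) / (1 + ζ)))

/-- The inverse of `stripMap a b`. -/
noncomputable def stripInv (a b : ℝ) (w : ℂ) : ℂ :=
  (Complex.I - stripExp a b w) / (Complex.I + stripExp a b w)

theorem norm_stripExp (a b : ℝ) (w : ℂ) :
    ‖stripExp a b w‖ = Real.exp (Real.pi / (b - a) * w.re) := by
  rw [stripExp, Complex.norm_exp, Complex.re_ofReal_mul]
  simp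

theorem stripExp_im (a b : ℝ) (w : ℂ) : (stripExp a b w).im =
    Real.exp (Real.pi / (b - a) * w.re) * Real.sin (Real.pi / (b - a) * (w.im - a)) := by
  rw [stripExp, Complex.exp_im, Complex.re_ofReal_mul, Complex.im_ofReal_mul]
  simp

theorem stripExp_ne_zero (a b : ℝ) (w : ℂ) : stripExp a b w ≠ 0 := Complex.exp_ne_zero _

theorem differentiable_stripExp (a b : ℝ) : Differentiable ℂ (stripExp a b) := by
  unfold stripExp
  fun_prop

theorem stripExp_div (a b : ℝ) (v w : ℂ) : stripExp a b v / stripExp a b w =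
    Complex.exp ((Real.pi / (b - a) : ℝ) * (v - w)) := by
  rw [stripExp, stripExp, ← Complex.exp_sub]
  congr 1
  ring

theorem stripExp_im_pos {a b : ℝ} {w : ℂ} (hw : w ∈ hstrip a b) : 0 < (stripExp a b w).im := by
  have hab : 0 < b - a := by linarith [hw.1, hw.2]
  rw [stripExp_im]
  refine mul_pos (Real.exp_pos _) (Real.sin_pos_of_pos_of_lt_pi ?_ ?_)
  · exact mul_pos (div_pos Real.pi_pos hab) (by linarith [hw.1])
  · rw [div_mul_eq_mul_div, div_lt_iff₀ hab]
    exact mul_lt_mul_of_pos_left (by linarith [hw.2]) Real.pi_pos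

theorem one_add_ne_zero_of_mem {ζ : ℂ} (hζ : ζ ∈ unitDisk) : 1 + ζ ≠ 0 := by
  intro h
  rw [mem_unitDisk, ← neg_eq_of_add_eq_zero_right h] at hζ
  simp at hζ

theorem one_sub_ne_zero_of_mem {ζ : ℂ} (hζ : ζ ∈ unitDisk) : 1 - ζ ≠ 0 := by
  intro h
  rw [mem_unitDisk, ← sub_eq_zero.mp h] at hζ
  simp at hζ

theorem im_I_mul_cayley {ζ : ℂ} (hζ : ζ ∈ unitDisk) :
    (Complex.I * ((1 - ζ) / (1 + ζ))).im = (1 - ‖ζ‖ ^ 2) / ‖1 + ζ‖ ^ 2 := by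
  have h0 : Complex.normSq (1 + ζ) ≠ 0 := by simpa using one_add_ne_zero_of_mem hζ
  rw [Complex.I_mul_im, Complex.div_re, Complex.sq_norm, Complex.sq_norm, ← add_div]
  congr 1
  simp [Complex.normSq_apply]
  ring

theorem im_I_mul_cayley_pos {ζ : ℂ} (hζ : ζ ∈ unitDisk) :
    0 < (Complex.I * ((1 - ζ) / (1 + ζ))).im := by
  rw [im_I_mul_cayley hζ]
  exact div_pos (one_sub_norm_sq_pos hζ) (pow_pos (norm_pos_iff.mpr (one_add_ne_zero_of_mem hζ)) 2)

theorem I_mul_cayley_ne_zero {ζ : ℂ} (hζ : ζ ∈ unitDisk) :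
    Complex.I * ((1 - ζ) / (1 + ζ)) ≠ 0 := fun h => by
  have := im_I_mul_cayley_pos hζ
  simp [h] at this

section Strip

variable {a b : ℝ}

theorem stripExp_stripMap (hab : a < b) {ζ : ℂ} (hζ : ζ ∈ unitDisk) :
    stripExp a b (stripMap a b ζ) = Complex.I * ((1 - ζ) / (1 + ζ)) := by
  have h1 : ((Real.pi / (b - a) : ℝ) : ℂ) * ((b - a) / Real.pi : ℝ) = 1 := by
    rw [← Complex.ofReal_mul]
    have : b - a ≠ 0 := by linarith
    field_simp
    simp
  rw [stripExp, stripMap, add_sub_cancel_left, ← mul_assoc, h1, one_mul,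
    Complex.exp_log (I_mul_cayley_ne_zero hζ)]

theorem stripMap_re (ζ : ℂ) :
    (stripMap a b ζ).re = (b - a) / Real.pi * Real.log (‖1 - ζ‖ / ‖1 + ζ‖) := by
  rw [stripMap, Complex.add_re, Complex.re_ofReal_mul, Complex.re_ofReal_mul, Complex.log_re]
  simp

theorem stripMap_im (ζ : ℂ) : (stripMap a b ζ).im =
    a + (b - a) / Real.pi * Complex.arg (Complex.I * ((1 - ζ) / (1 + ζ))) := by
  rw [stripMap, Complex.add_im, Complex.im_ofReal_mul, Complex.im_ofReal_mul, Complex.log_im]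
  simp

/-- The inequality `δ * ‖1 - ζ‖ * ‖1 + ζ‖ ≤ 1 - ‖ζ‖ ^ 2` describes an approach region at both
points `1` and `-1`; it corresponds to a narrower strip. -/
theorem stripMap_im_bounds (hab : a < b) {ζ : ℂ} (hζ : ζ ∈ unitDisk) {δ : ℝ}
    (h : δ * (‖1 - ζ‖ * ‖1 + ζ‖) ≤ 1 - ‖ζ‖ ^ 2) :
    a + (b - a) / Real.pi * δ ≤ (stripMap a b ζ).im ∧
      (stripMap a b ζ).im ≤ b - (b - a) / Real.pi * δ := by
  set E := Complex.I * ((1 - ζ) / (1 + ζ)) with hE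
  have hE0 := I_mul_cayley_ne_zero hζ
  have him := im_I_mul_cayley_pos hζ
  have h1 : δ ≤ Real.sin (Complex.arg E) := by
    rw [Complex.sin_arg, le_div_iff₀ (norm_pos_iff.mpr hE0), im_I_mul_cayley hζ]
    have h2 : 0 < ‖1 + ζ‖ := norm_pos_iff.mpr (one_add_ne_zero_of_mem hζ)
    rw [le_div_iff₀ (by positivity), norm_mul, norm_div, Complex.norm_I, one_mul]
    calc δ * (‖1 - ζ‖ / ‖1 + ζ‖) * ‖1 + ζ‖ ^ 2 = δ * (‖1 - ζ‖ * ‖1 + ζ‖) := by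
          field_simp
      _ ≤ _ := h
  have h3 : 0 < Complex.arg E := by
    refine lt_of_le_of_ne (Complex.arg_nonneg_iff.mpr him.le) fun h0 => ?_
    rw [eq_comm, Complex.arg_eq_zero_iff] at h0
    exact him.ne' h0.2
  have h4 := Complex.arg_le_pi E
  have h5 : δ ≤ Complex.arg E := h1.trans (Real.sin_le h3.le)
  have h6 : δ ≤ Real.pi - Complex.arg E := by
    rw [← Real.sin_pi_sub] at h1
    exact h1.trans (Real.sin_le (by linarith))
  have hc : 0 ≤ (b - a) / Real.pi := div_nonneg (by linarith) Real.pi_pos.le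
  rw [stripMap_im]
  have h7 : (b - a) / Real.pi * Real.pi = b - a := div_mul_cancel₀ _ Real.pi_pos.ne'
  constructor
  · linarith [mul_le_mul_of_nonneg_left h5 hc]
  · linarith [mul_le_mul_of_nonneg_left h6 hc]

theorem stripMap_mem (hab : a < b) {ζ : ℂ} (hζ : ζ ∈ unitDisk) : stripMap a b ζ ∈ hstrip a b := by
  have h1 : 0 < ‖1 - ζ‖ * ‖1 + ζ‖ := mul_pos (norm_pos_iff.mpr (one_sub_ne_zero_of_mem hζ))
    (norm_pos_iff.mpr (one_add_ne_zero_of_mem hζ))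
  have h2 : 0 < (1 - ‖ζ‖ ^ 2) / (‖1 - ζ‖ * ‖1 + ζ‖) := div_pos (one_sub_norm_sq_pos hζ) h1
  have h3 := stripMap_im_bounds hab hζ (div_mul_cancel₀ (1 - ‖ζ‖ ^ 2) h1.ne').le
  have h4 := mul_pos (div_pos (sub_pos.mpr hab) Real.pi_pos) h2
  exact ⟨by linarith [h3.1], by linarith [h3.2]⟩

theorem I_add_ne_zero_of_im_pos {E : ℂ} (hE : 0 < E.im) : Complex.I + E ≠ 0 := by
  intro h
  have := congrArg Complex.im h
  simp at this
  linarith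

theorem one_sub_stripInv {w : ℂ} (hw : w ∈ hstrip a b) :
    1 - stripInv a b w = 2 * stripExp a b w / (Complex.I + stripExp a b w) := by
  have h := I_add_ne_zero_of_im_pos (stripExp_im_pos hw)
  rw [stripInv, eq_div_iff h, sub_mul, div_mul_cancel₀ _ h]
  ring

theorem one_sub_norm_stripInv_sq {w : ℂ} (hw : w ∈ hstrip a b) :
    1 - ‖stripInv a b w‖ ^ 2 =
      4 * (stripExp a b w).im / ‖Complex.I + stripExp a b w‖ ^ 2 := by
  have h := norm_ne_zero_iff.mpr (I_add_ne_zero_of_im_pos (stripExp_im_pos hw))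
  rw [stripInv, norm_div, div_pow, eq_div_iff (by positivity), sub_mul,
    div_mul_cancel₀ _ (by positivity), Complex.sq_norm, Complex.sq_norm]
  simp [Complex.normSq_apply]
  ring

theorem stripInv_mem {w : ℂ} (hw : w ∈ hstrip a b) : stripInv a b w ∈ unitDisk := by
  have h1 := one_sub_norm_stripInv_sq hw
  have h2 : 0 < 4 * (stripExp a b w).im / ‖Complex.I + stripExp a b w‖ ^ 2 :=
    div_pos (by linarith [stripExp_im_pos hw])
      (pow_pos (norm_pos_iff.mpr (I_add_ne_zero_of_im_pos (stripExp_im_pos hw))) 2)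
  rw [mem_unitDisk]
  nlinarith [norm_nonneg (stripInv a b w)]

theorem stripInv_stripMap (hab : a < b) {ζ : ℂ} (hζ : ζ ∈ unitDisk) :
    stripInv a b (stripMap a b ζ) = ζ := by
  have h := one_add_ne_zero_of_mem hζ
  have h2 := I_add_ne_zero_of_im_pos (im_I_mul_cayley_pos hζ)
  rw [stripInv, stripExp_stripMap hab hζ, div_eq_iff h2]
  field_simp
  ring

theorem stripMap_stripInv {w : ℂ} (hw : w ∈ hstrip a b) :
    stripMap a b (stripInv a b w) = w := by
  have hab : 0 < b - a := by linarith [hw.1, hw.2]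
  have h := I_add_ne_zero_of_im_pos (stripExp_im_pos hw)
  have h1 : 1 + stripInv a b w = 2 * Complex.I / (Complex.I + stripExp a b w) := by
    rw [stripInv, eq_div_iff h, add_mul, div_mul_cancel₀ _ h]
    ring
  have h2 : Complex.I * ((1 - stripInv a b w) / (1 + stripInv a b w)) = stripExp a b w := by
    rw [one_sub_stripInv hw, h1]
    field_simp [Complex.I_ne_zero]
  have h3 : ((b - a) / Real.pi : ℝ) * ((Real.pi / (b - a) : ℝ) : ℂ) = 1 := by
    rw [← Complex.ofReal_mul]
    field_simp
    simp
  have h4 : (((Real.pi / (b - a) : ℝ) : ℂ) * (w - a * Complex.I)).im =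
      Real.pi / (b - a) * (w.im - a) := by
    rw [Complex.im_ofReal_mul]; simp
  rw [stripMap, h2, stripExp, Complex.log_exp, ← mul_assoc, h3]
  · ring
  · rw [h4]
    have : 0 < Real.pi / (b - a) * (w.im - a) :=
      mul_pos (div_pos Real.pi_pos hab) (by linarith [hw.1])
    linarith [Real.pi_pos]
  · rw [h4, div_mul_eq_mul_div, div_le_iff₀ hab]
    exact mul_le_mul_of_nonneg_left (by linarith [hw.2]) Real.pi_pos.le

theorem isConformalOnto_stripMap (hab : a < b) :
    IsConformalOnto (stripMap a b) unitDisk (hstrip a b) := by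
  refine ⟨fun ζ hζ => ?_, fun z hz w hw hzw => ?_, ?_⟩
  · have h1 := one_add_ne_zero_of_mem hζ
    have h2 : Complex.I * ((1 - ζ) / (1 + ζ)) ∈ Complex.slitPlane :=
      Or.inr (im_I_mul_cayley_pos hζ).ne'
    unfold stripMap
    apply DifferentiableAt.differentiableWithinAt
    fun_prop (disch := assumption)
  · rw [← stripInv_stripMap hab hz, hzw, stripInv_stripMap hab hw]
  · ext w
    constructor
    · rintro ⟨ζ, hζ, rfl⟩; exact stripMap_mem hab hζ
    · intro hw; exact ⟨_, stripInv_mem hw, stripMap_stripInv hw⟩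

theorem isConformalOnto_stripInv (hab : a < b) :
    IsConformalOnto (stripInv a b) (hstrip a b) unitDisk := by
  refine ⟨fun w hw => ?_, fun z hz w hw hzw => ?_, ?_⟩
  · have h1 := I_add_ne_zero_of_im_pos (stripExp_im_pos hw)
    have h2 := (differentiable_stripExp a b) w
    unfold stripInv
    apply DifferentiableAt.differentiableWithinAt
    fun_prop (disch := assumption)
  · rw [← stripMap_stripInv hz, hzw, stripMap_stripInv hw]
  · ext ζ
    constructor
    · rintro ⟨w, hw, rfl⟩; exact stripInv_mem hw
    · intro hζ; exact ⟨_, stripMap_mem hab hζ, stripInv_stripMap hab hζ⟩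

/-! ### Angular approach at `1` and the sets `stripTail` -/

theorem mem_stripTail_iff (hab : a < b) {ε : ℝ} {z : ℂ} : z ∈ stripTail a b ε ↔
    z ∈ hstrip a b ∧ z.re ≤ 0 ∧ a + ε / 2 ≤ z.im ∧ z.im ≤ b - ε / 2 := by
  have hfr : frontier (hstrip a b) = {w : ℂ | w.im = a ∨ w.im = b} := by
    have h1 : hstrip a b = Complex.im ⁻¹' Ioo a b := rfl
    rw [h1, Complex.frontier_preimage_im, frontier_Ioo hab]
    rfl
  have hne : (frontier (hstrip a b)).Nonempty := ⟨a * Complex.I, by rw [hfr]; simp⟩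
  simp only [stripTail, mem_ofPred_eq]
  refine and_congr_right fun hz => and_congr_right fun _ => ?_
  rw [Metric.le_infDist hne, hfr]
  have hd : ∀ c : ℝ, dist z (z.re + c * Complex.I) = |z.im - c| := fun c => by
    have : z - (z.re + c * Complex.I) = (z.im - c : ℝ) * Complex.I := by
      apply Complex.ext <;> simp
    rw [dist_eq_norm_sub, this, norm_mul, Complex.norm_I, mul_one, Complex.norm_real,
      Real.norm_eq_abs]
  constructor
  · intro H
    have h1 := @H (z.re + a * Complex.I) (by simp)
    have h2 := @H (z.re + b * Complex.I) (by simp)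
    rw [hd, abs_of_pos (by linarith [hz.1])] at h1
    rw [hd, abs_of_neg (by linarith [hz.2])] at h2
    exact ⟨by linarith, by linarith⟩
  · rintro ⟨h1, h2⟩ w hw
    have h3 : |z.im - w.im| ≤ dist z w := by
      rw [dist_eq_norm_sub, ← Complex.sub_im]; exact Complex.abs_im_le_norm _
    rcases hw with hw | hw
    · rw [hw] at h3
      linarith [le_abs_self (z.im - a)]
    · rw [hw] at h3
      linarith [neg_le_abs (z.im - b)]

theorem stolzSet_subset_unitDisk (M : ℝ) : Complex.stolzSet M ⊆ unitDisk :=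
  fun _ hz => mem_unitDisk.mpr hz.1

theorem tendsto_cobounded_of_re_atBot {ι : Type*} {l : Filter ι} {f : ι → ℂ}
    (h : Tendsto (fun i => (f i).re) l atBot) : Tendsto f l (Bornology.cobounded ℂ) := by
  rw [← tendsto_norm_atTop_iff_cobounded]
  exact tendsto_atTop_mono (fun i => Complex.abs_re_le_norm (f i)) (tendsto_abs_atBot_atTop.comp h)

/-- A Stolz angle at `1` is mapped by `stripMap` into some `stripTail`. -/
theorem tendsto_stripMap (hab : a < b) (M : ℝ) : ∃ ε ∈ Ioo 0 (b - a),
    Tendsto (stripMap a b) (𝓝[Complex.stolzSet M] 1)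
      (Bornology.cobounded ℂ ⊓ 𝓟 (stripTail a b ε)) := by
  rcases le_or_gt M 1 with hM | hM
  · refine ⟨(b - a) / 2, ⟨by linarith, by linarith⟩, ?_⟩
    rw [Complex.stolzSet_empty hM, nhdsWithin_empty]
    exact tendsto_bot
  have hL : 0 < b - a := by linarith
  have hδ : 0 < (b - a) / Real.pi * (1 / (2 * M)) := by positivity
  have hδ' : (b - a) / Real.pi * (1 / (2 * M)) < (b - a) / 2 := by
    have h1 : (b - a) / Real.pi < b - a := div_lt_self hL (by linarith [Real.pi_gt_three])
    have h2 : 1 / (2 * M) < 1 / 2 := one_div_lt_one_div_of_lt (by norm_num) (by linarith)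
    have h3 : 0 < 1 / (2 * M) := by positivity
    nlinarith
  have hre : Tendsto (fun ζ => (stripMap a b ζ).re) (𝓝[Complex.stolzSet M] 1) atBot := by
    simp only [stripMap_re]
    refine Tendsto.const_mul_atBot (div_pos hL Real.pi_pos) ?_
    refine Real.tendsto_log_nhdsGT_zero.comp (tendsto_nhdsWithin_iff.mpr ⟨?_, ?_⟩)
    · have h1 : ContinuousAt (fun ζ : ℂ => ‖1 - ζ‖ / ‖1 + ζ‖) 1 := by
        refine ContinuousAt.div (by fun_prop) (by fun_prop) ?_
        norm_num
      have h2 := h1.tendsto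
      simp only [sub_self, norm_zero, zero_div] at h2
      exact h2.mono_left nhdsWithin_le_nhds
    · filter_upwards [self_mem_nhdsWithin] with ζ hζ
      have hζ' := stolzSet_subset_unitDisk M hζ
      exact div_pos (norm_pos_iff.mpr (one_sub_ne_zero_of_mem hζ'))
        (norm_pos_iff.mpr (one_add_ne_zero_of_mem hζ'))
  refine ⟨2 * ((b - a) / Real.pi * (1 / (2 * M))), ⟨by linarith, by linarith⟩, ?_⟩
  refine tendsto_inf.mpr ⟨tendsto_cobounded_of_re_atBot hre, tendsto_principal.mpr ?_⟩
  filter_upwards [hre.eventually_le_atBot 0, self_mem_nhdsWithin] with ζ h1 hζ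
  have hζ' := stolzSet_subset_unitDisk M hζ
  rw [mem_stripTail_iff hab, mul_div_cancel_left₀ _ (two_ne_zero' ℝ)]
  refine ⟨stripMap_mem hab hζ', h1, stripMap_im_bounds hab hζ' ?_⟩
  have h2 : ‖1 + ζ‖ ≤ 2 := (norm_add_le _ _).trans (by rw [norm_one]; linarith [hζ.1])
  have h3 : ‖1 - ζ‖ * ‖1 + ζ‖ ≤ M * (1 - ‖ζ‖) * 2 :=
    mul_le_mul hζ.2.le h2 (norm_nonneg _) ((norm_nonneg _).trans hζ.2.le)
  calc 1 / (2 * M) * (‖1 - ζ‖ * ‖1 + ζ‖) ≤ 1 / (2 * M) * (M * (1 - ‖ζ‖) * 2) := by gcongr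
    _ = 1 - ‖ζ‖ := by field_simp
    _ ≤ 1 - ‖ζ‖ ^ 2 := by nlinarith [norm_nonneg ζ, hζ.1]

theorem tendsto_re_stripTail (a b ε : ℝ) :
    Tendsto Complex.re (Bornology.cobounded ℂ ⊓ 𝓟 (stripTail a b ε)) atBot := by
  have h1 : Tendsto (fun w : ℂ => |a| + |b| - ‖w‖)
      (Bornology.cobounded ℂ ⊓ 𝓟 (stripTail a b ε)) atBot := by
    simp only [sub_eq_add_neg]
    exact tendsto_atBot_add_const_left _ _
      (tendsto_neg_atTop_atBot.comp (tendsto_norm_cobounded_atTop.mono_left inf_le_left))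
  refine tendsto_atBot_mono' _ ?_ h1
  have h2 : ∀ᶠ w in Bornology.cobounded ℂ ⊓ 𝓟 (stripTail a b ε), w ∈ stripTail a b ε :=
    mem_inf_of_right (mem_principal_self _)
  filter_upwards [h2] with w hw
  have h3 := Complex.norm_le_abs_re_add_abs_im w
  rw [abs_of_nonpos hw.2.1] at h3
  have h4 : |w.im| ≤ |a| + |b| := by
    rw [abs_le]
    constructor
    · linarith [neg_abs_le a, abs_nonneg b, hw.1.1]
    · linarith [le_abs_self b, abs_nonneg a, hw.1.2]
  linarith

theorem tendsto_stripExp_stripTail (hab : a < b) (ε : ℝ) :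
    Tendsto (stripExp a b) (Bornology.cobounded ℂ ⊓ 𝓟 (stripTail a b ε)) (𝓝 0) := by
  rw [tendsto_zero_iff_norm_tendsto_zero]
  simp only [norm_stripExp]
  exact Real.tendsto_exp_atBot.comp ((tendsto_re_stripTail a b ε).const_mul_atBot
    (div_pos Real.pi_pos (by linarith)))

/-- Each `stripTail` is mapped by `stripInv` into some Stolz angle at `1`. -/
theorem tendsto_stripInv (hab : a < b) {ε : ℝ} (hε : ε ∈ Ioo 0 (b - a)) : ∃ M : ℝ,
    Tendsto (stripInv a b) (Bornology.cobounded ℂ ⊓ 𝓟 (stripTail a b ε))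
      (𝓝[Complex.stolzSet M] 1) := by
  have hL : 0 < b - a := by linarith
  set θ := Real.pi / (b - a) * (ε / 2) with hθ
  have hθ0 : 0 < θ := mul_pos (div_pos Real.pi_pos hL) (by linarith [hε.1])
  have hθ1 : θ ≤ Real.pi / 2 := by
    rw [hθ, div_mul_eq_mul_div, div_le_div_iff₀ hL two_pos]
    nlinarith [Real.pi_pos, hε.2]
  have hs : 0 < Real.sin θ := Real.sin_pos_of_pos_of_lt_pi hθ0 (by linarith [Real.pi_pos])
  have hE := tendsto_stripExp_stripTail hab ε
  have hmem : ∀ᶠ w in Bornology.cobounded ℂ ⊓ 𝓟 (stripTail a b ε), w ∈ stripTail a b ε :=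
    mem_inf_of_right (mem_principal_self _)
  refine ⟨2 / Real.sin θ + 1, tendsto_nhdsWithin_iff.mpr ⟨?_, ?_⟩⟩
  · have : Tendsto (stripInv a b) (Bornology.cobounded ℂ ⊓ 𝓟 (stripTail a b ε))
        (𝓝 ((Complex.I - 0) / (Complex.I + 0))) :=
      (hE.const_sub _).div (hE.const_add _) (by simp)
    simpa using this
  · filter_upwards [hmem, hE.norm.eventually_lt_const (by simp : ‖(0 : ℂ)‖ < 1)] with w hw hw1
    rw [mem_stripTail_iff hab] at hw
    obtain ⟨hwS, -, hw2, hw3⟩ := hw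
    have hpD := mem_unitDisk.mp (stripInv_mem hwS)
    refine ⟨hpD, ?_⟩
    have him := stripExp_im_pos hwS
    have hI := norm_pos_iff.mpr (I_add_ne_zero_of_im_pos him)
    have hsin : Real.sin θ ≤ Real.sin (Real.pi / (b - a) * (w.im - a)) := by
      have h1 : θ ≤ Real.pi / (b - a) * (w.im - a) := by
        rw [hθ]; gcongr; linarith
      have h2 : Real.pi / (b - a) * (w.im - a) ≤ Real.pi - θ := by
        have h3 : Real.pi - θ = Real.pi / (b - a) * (b - a - ε / 2) := by
          rw [hθ, mul_sub, div_mul_cancel₀ _ hL.ne']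
        rw [h3]
        exact mul_le_mul_of_nonneg_left (by linarith) (div_pos Real.pi_pos hL).le
      rcases le_total (Real.pi / (b - a) * (w.im - a)) (Real.pi / 2) with h4 | h4
      · exact Real.sin_le_sin_of_le_of_le_pi_div_two (by linarith) h4 h1
      · rw [← Real.sin_pi_sub (Real.pi / (b - a) * (w.im - a))]
        exact Real.sin_le_sin_of_le_of_le_pi_div_two (by linarith) (by linarith) (by linarith)
    have hn : ‖stripExp a b w‖ * Real.sin θ ≤ (stripExp a b w).im := by
      rw [norm_stripExp, stripExp_im]
      exact mul_le_mul_of_nonneg_left hsin (Real.exp_pos _).le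
    have hI2 : ‖Complex.I + stripExp a b w‖ ≤ 2 := by
      refine (norm_add_le _ _).trans ?_
      rw [Complex.norm_I]; linarith
    have h1 := one_sub_norm_stripInv_sq hwS
    -- `‖1 - ζ‖ sin θ ≤ 1 - ‖ζ‖ ^ 2 ≤ 2 (1 - ‖ζ‖)` for `ζ = stripInv a b w`
    have h2 : ‖1 - stripInv a b w‖ * Real.sin θ ≤ 1 - ‖stripInv a b w‖ ^ 2 := by
      rw [h1, one_sub_stripInv hwS, norm_div, norm_mul, Complex.norm_ofNat, div_mul_eq_mul_div,
        div_le_div_iff₀ hI (by positivity)]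
      have h3 : 2 * (‖stripExp a b w‖ * Real.sin θ) * ‖Complex.I + stripExp a b w‖ ≤
          2 * (stripExp a b w).im * 2 :=
        mul_le_mul (by linarith) hI2 hI.le (by linarith)
      calc 2 * ‖stripExp a b w‖ * Real.sin θ * ‖Complex.I + stripExp a b w‖ ^ 2
          = 2 * (‖stripExp a b w‖ * Real.sin θ) * ‖Complex.I + stripExp a b w‖ *
            ‖Complex.I + stripExp a b w‖ := by ring
        _ ≤ 2 * (stripExp a b w).im * 2 * ‖Complex.I + stripExp a b w‖ := by gcongr
        _ = _ := by ring
    have h4 : ‖1 - stripInv a b w‖ * Real.sin θ ≤ 2 * (1 - ‖stripInv a b w‖) := by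
      nlinarith [norm_nonneg (stripInv a b w)]
    have h5 : ‖1 - stripInv a b w‖ ≤ 2 / Real.sin θ * (1 - ‖stripInv a b w‖) := by
      rw [div_mul_eq_mul_div, le_div_iff₀ hs]
      exact h4
    linarith

/-- A horizontal line in the strip, run to the left, is eventually in `stripTail`. -/
theorem tendsto_line_stripTail (hab : a < b) {ε y : ℝ} (hε : 0 < ε) (h1 : a + ε / 2 ≤ y)
    (h2 : y ≤ b - ε / 2) : Tendsto (fun t : ℝ => (t + y * Complex.I : ℂ)) atBot
      (Bornology.cobounded ℂ ⊓ 𝓟 (stripTail a b ε)) := by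
  refine tendsto_inf.mpr ⟨tendsto_cobounded_of_re_atBot (tendsto_id.congr fun t => by simp),
    tendsto_principal.mpr ?_⟩
  filter_upwards [eventually_le_atBot 0] with t ht
  rw [mem_stripTail_iff hab]
  refine ⟨⟨?_, ?_⟩, ?_, ?_, ?_⟩ <;> simp <;> linarith

theorem tendsto_radius_stolzSet :
    Tendsto (fun r : ℝ => (r : ℂ)) (𝓝[<] 1) (𝓝[Complex.stolzSet 2] 1) :=
  Complex.nhdsWithin_lt_le_nhdsWithin_stolzSet one_lt_two

end Strip

/-! ### Boundedness of the Poisson kernel on bounded parts of the strip -/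

/-- If `Re H ≥ 0` on the closed square with centre `0` and half-side `s`, and `Re H ≥ M` on its
right side, then `Re H 0 ≥ M / 4`: apply the maximum principle to the product of the four rotations
of `exp (-H)`. -/
theorem div_four_le_re_of_square {H : ℂ → ℂ} {s M : ℝ} (hs : 0 < s)
    (hH : DifferentiableOn ℂ H (Icc (-s) s ×ℂ Icc (-s) s))
    (hpos : ∀ z ∈ Icc (-s) s ×ℂ Icc (-s) s, 0 ≤ (H z).re)
    (hM : ∀ x ∈ Icc (-s) s, M ≤ (H (s + x * Complex.I)).re) : M / 4 ≤ (H 0).re := by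
  set Q := Icc (-s) s ×ℂ Icc (-s) s with hQ
  set U := Ioo (-s) s ×ℂ Ioo (-s) s with hU
  have hcl : closure U = Q := by
    rw [hU, Complex.closure_reProdIm, closure_Ioo (by linarith)]
  have hrot : ∀ u ∈ ({1, -1, Complex.I, -Complex.I} : Set ℂ), ∀ z ∈ Q, u * z ∈ Q := by
    rintro u hu z ⟨⟨h1, h2⟩, h3, h4⟩
    simp only [mem_insert_iff, mem_singleton_iff] at hu
    rcases hu with rfl | rfl | rfl | rfl <;> refine ⟨⟨?_, ?_⟩, ?_, ?_⟩ <;> simp <;> linarith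
  set K : ℂ → ℂ := fun z => Complex.exp
    (-(H (1 * z) + H (-1 * z) + H (Complex.I * z) + H (-Complex.I * z))) with hK
  have hd : ∀ u ∈ ({1, -1, Complex.I, -Complex.I} : Set ℂ),
      DifferentiableOn ℂ (fun z => H (u * z)) Q := fun u hu =>
    hH.comp (by fun_prop) (hrot u hu)
  have hKd : DifferentiableOn ℂ K Q :=
    ((((hd 1 (by simp)).add (hd (-1) (by simp))).add (hd Complex.I (by simp))).add
      (hd (-Complex.I) (by simp))).neg.cexp
  have hKn : ∀ z, ‖K z‖ = Real.exp (-((H (1 * z)).re + (H (-1 * z)).re + (H (Complex.I * z)).re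
      + (H (-Complex.I * z)).re)) := fun z => by
    simp only [hK, Complex.norm_exp, Complex.neg_re, Complex.add_re]
  have hbd : Bornology.IsBounded U :=
    (Metric.isBounded_Ioo _ _).reProdIm (Metric.isBounded_Ioo _ _)
  have hUo : IsOpen U := isOpen_Ioo.reProdIm isOpen_Ioo
  have hfr : ∀ z ∈ frontier U, ‖K z‖ ≤ Real.exp (-M) := by
    intro z hz
    rw [hUo.frontier_eq, hcl] at hz
    obtain ⟨hzQ, hzU⟩ := hz
    have p1 := hpos _ (hrot 1 (by simp) z hzQ)
    have p2 := hpos _ (hrot (-1) (by simp) z hzQ)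
    have p3 := hpos _ (hrot Complex.I (by simp) z hzQ)
    have p4 := hpos _ (hrot (-Complex.I) (by simp) z hzQ)
    have hside : ∀ v ∈ Q, v.re = s → M ≤ (H v).re := fun v hv hvs => by
      have := hM v.im hv.2
      rwa [← hvs, Complex.re_add_im] at this
    rw [hKn, Real.exp_le_exp, neg_le_neg_iff]
    have hcase : z.re = s ∨ z.re = -s ∨ z.im = s ∨ z.im = -s := by
      by_contra! hne
      exact hzU ⟨⟨lt_of_le_of_ne hzQ.1.1 hne.2.1.symm, lt_of_le_of_ne hzQ.1.2 hne.1⟩,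
        lt_of_le_of_ne hzQ.2.1 hne.2.2.2.symm, lt_of_le_of_ne hzQ.2.2 hne.2.2.1⟩
    rcases hcase with h | h | h | h
    · linarith [hside _ (hrot 1 (by simp) z hzQ) (by simp [h])]
    · linarith [hside _ (hrot (-1) (by simp) z hzQ) (by simp [h])]
    · linarith [hside _ (hrot (-Complex.I) (by simp) z hzQ) (by simp [h])]
    · linarith [hside _ (hrot Complex.I (by simp) z hzQ) (by simp [h])]
  have h0 : (0 : ℂ) ∈ closure U := by
    rw [hcl]
    refine ⟨⟨?_, ?_⟩, ?_, ?_⟩ <;> simp <;> linarith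
  have hdc : DiffContOnCl ℂ K U := DifferentiableOn.diffContOnCl (hcl ▸ hKd)
  have h1 := Complex.norm_le_of_forall_mem_frontier_norm_le hbd hdc hfr h0
  rw [hKn, Real.exp_le_exp, neg_le_neg_iff] at h1
  simp only [mul_zero] at h1
  linarith

/-- A square version of the minimum principle in a strip: if `Re G ≥ M` on a short horizontal
segment starting at `w`, which may be close to the boundary, then `Re G ≥ M / 4` at a nearby point
away from the boundary. -/
theorem exists_div_four_le_re {G : ℂ → ℂ} {a b M : ℝ} {w : ℂ}
    (hG : DifferentiableOn ℂ G (hstrip a b)) (hpos : ∀ z ∈ hstrip a b, 0 ≤ (G z).re)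
    (hw : w ∈ hstrip a b)
    (hM : ∀ t ∈ Icc 0 ((b - a) / 4), M ≤ (G (w + (t : ℝ))).re) :
    ∃ c : ℂ, c.re = w.re + (b - a) / 8 ∧ c.im ∈ Icc (a + (b - a) / 8) (b - (b - a) / 8) ∧
      M / 4 ≤ (G c).re := by
  set s := (b - a) / 8 with hs
  have hs0 : 0 < s := by have := hw.1; have := hw.2; linarith
  -- The square is built above or below the segment, towards the middle of the strip; a rotation by
  -- a right angle takes the segment to the right side of the square.
  rcases le_total w.im ((a + b) / 2) with hmid | hmid
  · refine ⟨w + s + s * Complex.I, by simp, by simp; constructor <;> linarith [hw.1], ?_⟩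
    have hmaps : MapsTo (fun z : ℂ => w + s + s * Complex.I - Complex.I * z)
        (Icc (-s) s ×ℂ Icc (-s) s) (hstrip a b) := by
      rintro z ⟨⟨h1, h2⟩, h3, h4⟩
      constructor <;> simp <;> linarith [hw.1]
    have h1 := div_four_le_re_of_square (H := fun z => G (w + s + s * Complex.I - Complex.I * z))
      (M := M) hs0 (hG.comp (by fun_prop) hmaps) (fun z hz => hpos _ (hmaps hz)) ?_
    · simpa using h1
    · intro x hx
      have h2 := hM (s + x) ⟨by linarith [hx.1], by linarith [hx.2]⟩
      convert h2 using 3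
      push_cast
      linear_combination (-(x : ℂ)) * Complex.I_sq
  · refine ⟨w + s - s * Complex.I, by simp, by simp; constructor <;> linarith [hw.2], ?_⟩
    have hmaps : MapsTo (fun z : ℂ => w + s - s * Complex.I + Complex.I * z)
        (Icc (-s) s ×ℂ Icc (-s) s) (hstrip a b) := by
      rintro z ⟨⟨h1, h2⟩, h3, h4⟩
      constructor <;> simp <;> linarith [hw.2]
    have h1 := div_four_le_re_of_square (H := fun z => G (w + s - s * Complex.I + Complex.I * z))
      (M := M) hs0 (hG.comp (by fun_prop) hmaps) (fun z hz => hpos _ (hmaps hz)) ?_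
    · simpa using h1
    · intro x hx
      have h2 := hM (s - x) ⟨by linarith [hx.2], by linarith [hx.1]⟩
      convert h2 using 3
      push_cast
      linear_combination (x : ℂ) * Complex.I_sq

theorem sub_ne_zero_of_mem_unitDisk {σ z : ℂ} (hσ : ‖σ‖ = 1) (hz : z ∈ unitDisk) : σ - z ≠ 0 := by
  intro h
  rw [mem_unitDisk, ← sub_eq_zero.mp h] at hz
  linarith

/-- The Poisson kernel of the disk with pole at `σ` is the real part of `(σ + z) / (σ - z)`. -/
theorem re_herglotz {σ z : ℂ} (hσ : ‖σ‖ = 1) :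
    ((σ + z) / (σ - z)).re = (1 - ‖z‖ ^ 2) / ‖σ - z‖ ^ 2 := by
  have h1 : σ.re * σ.re + σ.im * σ.im = 1 := by
    rw [← Complex.normSq_apply, ← Complex.sq_norm, hσ, one_pow]
  rw [Complex.div_re, ← add_div, Complex.sq_norm, Complex.sq_norm]
  congr 1
  simp only [Complex.add_re, Complex.sub_re, Complex.add_im, Complex.sub_im, Complex.normSq_apply]
  linear_combination h1

theorem line_mem_hstrip {a b y : ℝ} (hy : y ∈ Ioo a b) (t : ℝ) :
    (t + y * Complex.I : ℂ) ∈ hstrip a b := by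
  simpa [hstrip] using hy

section Koenigs

variable {φ : ℝ → ℂ → ℂ} {h k : ℂ → ℂ} {Δ : Set ℂ} {σ : ℂ} {a b : ℝ}

theorem IsAlphaPoint.tendsto_line (hφ : IsOneParameterSemigroup φ) (hh : IsKoenigsFunction φ h)
    (hk : IsKoenigsInverse h k) (hΔD : Δ ⊆ unitDisk) (hσ : IsAlphaPoint φ Δ σ)
    (himg : h '' Δ = hstrip a b) {y : ℝ} (hy : y ∈ Ioo a b) :
    Tendsto (fun t : ℝ => k (t + y * Complex.I)) atBot (𝓝 σ) := by
  have hmem : ∀ w : ℂ, w.im = y → w ∈ h '' Δ := fun w hw => by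
    rw [himg]
    subst hw
    exact hy
  have h1 := hσ.tendsto hφ hh hk hΔD (w := y * Complex.I) (hmem _ (by simp))
    (fun t _ => image_mono hΔD (hmem _ (by simp)))
  refine (h1.comp tendsto_neg_atBot_atTop).congr fun t => ?_
  simp [add_comm]

theorem IsAlphaPoint.norm_eq_one (hφ : IsOneParameterSemigroup φ) (hh : IsKoenigsFunction φ h)
    (hΔD : Δ ⊆ unitDisk) (hσ : IsAlphaPoint φ Δ σ)
    (himg : h '' Δ = hstrip a b) (hab : a < b) : ‖σ‖ = 1 := by
  obtain ⟨k, hk⟩ := hh.exists_inverse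
  have hmem : ∀ w : ℂ, w.im = (a + b) / 2 → w ∈ h '' Δ := fun w hw => by
    rw [himg]
    constructor <;> rw [hw] <;> linarith
  have hmem2 : ∀ t : ℝ, 0 ≤ t → ((a + b) / 2 : ℝ) * Complex.I - t ∈ h '' unitDisk := fun t _ =>
    image_mono hΔD (hmem _ (by rw [Complex.sub_im, Complex.im_ofReal_mul]; simp))
  exact hk.norm_eq_one_of_tendsto hh hmem2
    (hσ.tendsto hφ hh hk hΔD (hmem _ (by rw [Complex.im_ofReal_mul]; simp)) hmem2)

/-- The Poisson kernel with pole at the `α`-point, transplanted to the Koenigs domain, is bounded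
on bounded parts of the strip of the petal, up to the boundary: by Julia's inequality, a large
value at one point forces large values on a horizontal segment to its right, and then at points
in a compact subset of the strip. -/
theorem exists_poisson_le (hφ : IsOneParameterSemigroup φ) (hh : IsKoenigsFunction φ h)
    (hk : IsKoenigsInverse h k) (hΔD : Δ ⊆ unitDisk) (hσ : IsAlphaPoint φ Δ σ)
    (himg : h '' Δ = hstrip a b) (hab : a < b) (B : ℝ) :
    ∃ C : ℝ, ∀ w ∈ hstrip a b, |w.re| ≤ B → (1 - ‖k w‖ ^ 2) / ‖σ - k w‖ ^ 2 ≤ C := by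
  have hσ1 := hσ.norm_eq_one hφ hh hΔD himg hab
  have hS : hstrip a b ⊆ h '' unitDisk := himg ▸ image_mono hΔD
  have hkD : MapsTo k (hstrip a b) unitDisk := fun w hw => hk.conformal.mapsTo (hS hw)
  have hkd : DifferentiableOn ℂ k (hstrip a b) := hk.conformal.holo.mono hS
  set G : ℂ → ℂ := fun w => (σ + k w) / (σ - k w) with hG
  have hGre : ∀ w, (G w).re = (1 - ‖k w‖ ^ 2) / ‖σ - k w‖ ^ 2 := fun w => re_herglotz hσ1
  have hGd : DifferentiableOn ℂ G (hstrip a b) :=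
    ((differentiableOn_const σ).add hkd).div ((differentiableOn_const σ).sub hkd)
      fun w hw => sub_ne_zero_of_mem_unitDisk hσ1 (hkD hw)
  have hGpos : ∀ w ∈ hstrip a b, 0 ≤ (G w).re := fun w hw => by
    rw [hGre]
    exact div_nonneg (one_sub_norm_sq_pos (hkD hw)).le (by positivity)
  have hjulia : ∀ w ∈ hstrip a b, ∀ t ∈ Icc 0 ((b - a) / 4),
      (G w).re / 3 ≤ (G (w + (t : ℝ))).re := by
    intro w hw t ht
    have hmid : (a + b) / 2 ∈ Ioo a b := ⟨by linarith, by linarith⟩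
    have hlim : Tendsto (fun s : ℝ => k (((a + b) / 2 : ℝ) * Complex.I - s)) atTop (𝓝 σ) := by
      refine ((hσ.tendsto_line hφ hh hk hΔD himg hmid).comp tendsto_neg_atTop_atBot).congr
        fun s => ?_
      simp only [Function.comp]
      congr 1
      push_cast
      ring
    have hball : ∀ s : ℝ, 0 ≤ s →
        Metric.ball (((a + b) / 2 : ℝ) * Complex.I - s) ((b - a) / 2) ⊆ h '' unitDisk := by
      intro s _ v hv
      refine hS ?_
      rw [mem_ball_iff_norm] at hv
      have h1 := (Complex.abs_im_le_norm _).trans_lt hv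
      rw [Complex.sub_im, Complex.sub_im, Complex.im_ofReal_mul, Complex.I_im, Complex.ofReal_im,
        abs_lt] at h1
      exact ⟨by linarith [h1.1], by linarith [h1.2]⟩
    have h1 := julia_semigroup hφ hh hk hlim hball ht.1 (by linarith [ht.2]) (hkD hw)
    rw [hk.semigroup_apply hφ hh (hS hw) ht.1] at h1
    have hwt : w + (t : ℂ) ∈ hstrip a b := by simpa [hstrip] using hw
    -- in a strip of half-width `R`, the Julia factor is at most `3` for `t ≤ R / 2`
    have hA : (1 + t / ((b - a) / 2)) / (1 - t / ((b - a) / 2)) ≤ 3 := by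
      have h2 : t / ((b - a) / 2) ≤ 1 / 2 := by
        rw [div_le_iff₀ (by linarith)]; linarith [ht.2]
      rw [div_le_iff₀ (by linarith)]
      linarith
    have p1 := norm_pos_iff.mpr (sub_ne_zero_of_mem_unitDisk hσ1 (hkD hw))
    have p2 := norm_pos_iff.mpr (sub_ne_zero_of_mem_unitDisk hσ1 (hkD hwt))
    have p3 := one_sub_norm_sq_pos (hkD hwt)
    rw [hGre, hGre, div_div, div_le_div_iff₀ (by positivity) (by positivity)]
    calc _ ≤ _ := h1
      _ ≤ 3 * (1 - ‖k (w + t)‖ ^ 2) * ‖σ - k w‖ ^ 2 := by gcongr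
      _ = _ := by ring
  -- the values of `Re G` on a compact rectangle
  have hcomp : IsCompact (Icc (-B) (B + (b - a) / 8) ×ℂ
      Icc (a + (b - a) / 8) (b - (b - a) / 8)) := isCompact_Icc.reProdIm isCompact_Icc
  have hsub : (Icc (-B) (B + (b - a) / 8) ×ℂ
      Icc (a + (b - a) / 8) (b - (b - a) / 8)) ⊆ hstrip a b := fun z hz =>
    ⟨by linarith [hz.2.1], by linarith [hz.2.2]⟩
  obtain ⟨C, hC⟩ := hcomp.bddAbove_image
    (Complex.continuous_re.comp_continuousOn (hGd.continuousOn.mono hsub))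
  refine ⟨12 * C, fun w hw hwB => ?_⟩
  obtain ⟨c, hc1, hc2, hc3⟩ := exists_div_four_le_re hGd hGpos hw (hjulia w hw)
  rw [abs_le] at hwB
  have h1 : (G c).re ≤ C := hC (mem_image_of_mem _
    ⟨⟨by rw [hc1]; linarith [hwB.1], by rw [hc1]; linarith [hwB.2]⟩, hc2⟩)
  rw [← hGre]
  linarith

/-! ### Forward orbits -/

/-- The forward orbits converge to the Denjoy–Wolff point uniformly on compact sets. -/
theorem IsDenjoyWolffPoint.tendsto_of_compact (hφ : IsOneParameterSemigroup φ) {τ : ℂ}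
    (hτ1 : ‖τ‖ = 1) (hτ : IsDenjoyWolffPoint φ τ) {K : Set ℂ} (hK : IsCompact K)
    (hKD : K ⊆ unitDisk) {ι : Type*} {l : Filter ι} {t : ι → ℝ} {z : ι → ℂ}
    (ht : Tendsto t l atTop) (hz : ∀ᶠ i in l, z i ∈ K) :
    Tendsto (fun i => φ (t i) (z i)) l (𝓝 τ) := by
  have h0 := zero_mem_unitDisk
  obtain ⟨r, hr0, hr1, hr⟩ : ∃ r : ℝ, 0 ≤ r ∧ r < 1 ∧ ∀ v ∈ K, ‖v‖ ≤ r := by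
    rcases K.eq_empty_or_nonempty with rfl | hne
    · exact ⟨0, le_rfl, one_pos, by simp⟩
    · obtain ⟨v, hv, hmax⟩ := hK.exists_isMaxOn hne continuous_norm.continuousOn
      exact ⟨‖v‖, norm_nonneg v, mem_unitDisk.mp (hKD hv), fun u hu => hmax hu⟩
  refine tendsto_of_pseudohyperbolic (z := fun i => φ (t i) 0) hr0 hr1 hτ1 ?_ ?_
    ((hτ.2 0 h0).comp ht)
  · filter_upwards [ht.eventually_ge_atTop 0] with i hi using hφ.mapsTo _ hi h0
  · filter_upwards [ht.eventually_ge_atTop 0, hz] with i hi hzi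
    have h1 := schwarz_pick (hφ.holo _ hi) (hφ.mapsTo _ hi) (hKD hzi) h0
    simp only [map_zero, zero_mul, sub_zero, norm_one, mul_one] at h1
    rw [norm_sub_rev]
    exact h1.trans (mul_le_mul_of_nonneg_right (hr _ hzi) (norm_nonneg _))

end Koenigs

/-! ### Conformality of the petal at the `α`-point in strip coordinates -/

/-- A holomorphic self-map of the disk which fixes the boundary point `1` and has a finite
derivative there preserves angular approach to `1`. -/
theorem tendsto_stolzSet_of_slope {n : ℂ → ℂ} (hn : DifferentiableOn ℂ n unitDisk)
    (hm : MapsTo n unitDisk unitDisk) {e : ℂ} (h1 : Tendsto n (𝓝[unitDisk] 1) (𝓝 1))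
    (he : Tendsto (fun z => (n z - 1) / (z - 1)) (𝓝[unitDisk] 1) (𝓝 e)) (M : ℝ) :
    ∃ M', Tendsto n (𝓝[Complex.stolzSet M] 1) (𝓝[Complex.stolzSet M'] 1) := by
  obtain ⟨c, hc, hcn⟩ := exists_mul_one_sub_norm_le hn hm
  have hle : 𝓝[Complex.stolzSet M] (1 : ℂ) ≤ 𝓝[unitDisk] 1 :=
    nhdsWithin_mono _ (stolzSet_subset_unitDisk M)
  refine ⟨(‖e‖ + 1) * M / c, tendsto_nhdsWithin_iff.mpr ⟨h1.mono_left hle, ?_⟩⟩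
  have h2 := (he.mono_left hle).norm.eventually_lt_const (lt_add_one ‖e‖)
  filter_upwards [h2, self_mem_nhdsWithin] with z hz hzM
  have hzD := stolzSet_subset_unitDisk M hzM
  refine ⟨mem_unitDisk.mp (hm hzD), ?_⟩
  have h3 : 0 < ‖1 - z‖ := norm_pos_iff.mpr (one_sub_ne_zero_of_mem hzD)
  rw [norm_div, norm_sub_rev z 1, norm_sub_rev _ (1 : ℂ), div_lt_iff₀ h3] at hz
  have h4 : (‖e‖ + 1) * ‖1 - z‖ < (‖e‖ + 1) * (M * (1 - ‖z‖)) :=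
    mul_lt_mul_of_pos_left hzM.2 (by positivity)
  have hM : 0 < M := pos_of_mul_pos_left (h3.trans hzM.2) (by linarith [hzM.1])
  calc ‖1 - n z‖ < (‖e‖ + 1) * M * (1 - ‖z‖) := by linarith
    _ = (‖e‖ + 1) * M / c * (c * (1 - ‖z‖)) := by field_simp
    _ ≤ _ := mul_le_mul_of_nonneg_left (hcn z hzD) (by positivity)

section Koenigs

variable {φ : ℝ → ℂ → ℂ} {h k : ℂ → ℂ} {Δ : Set ℂ} {σ : ℂ} {a b : ℝ}

theorem isConformalOnto_comp_stripMap (hk : IsKoenigsInverse h k) (hΔD : Δ ⊆ unitDisk)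
    (himg : h '' Δ = hstrip a b) (hab : a < b) :
    IsConformalOnto (fun ζ => k (stripMap a b ζ)) unitDisk Δ := by
  have hS : hstrip a b ⊆ h '' unitDisk := himg ▸ image_mono hΔD
  refine IsConformalOnto.comp ⟨hk.conformal.holo.mono hS, hk.conformal.inj.mono hS, ?_⟩
    (isConformalOnto_stripMap hab)
  rw [← himg, image_image]
  ext z
  constructor
  · rintro ⟨v, hv, rfl⟩
    simpa only [hk.left v (hΔD hv)] using hv
  · intro hz
    exact ⟨z, hz, hk.left z (hΔD hz)⟩

/-- If a holomorphic self-map of the disk has radial limit `σ` and finite radial derivative at `1`,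
the Poisson kernel with pole at `σ` tends to infinity along the image of the radius. -/
theorem tendsto_poisson_atTop {f : ℂ → ℂ} (hf : DifferentiableOn ℂ f unitDisk)
    (hm : MapsTo f unitDisk unitDisk) (hσ : ‖σ‖ = 1) {d : ℂ}
    (hd : Tendsto (fun r : ℝ => (f r - σ) / ((r : ℂ) - 1)) (𝓝[<] 1) (𝓝 d)) :
    Tendsto (fun r : ℝ => (1 - ‖f r‖ ^ 2) / ‖σ - f r‖ ^ 2) (𝓝[<] 1) atTop := by
  obtain ⟨c, hc, hcf⟩ := exists_mul_one_sub_norm_le hf hm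
  have hinv : Tendsto (fun r : ℝ => c / (‖d‖ + 1) ^ 2 * (1 - r)⁻¹) (𝓝[<] 1) atTop := by
    refine Tendsto.const_mul_atTop (by positivity) ?_
    refine tendsto_inv_nhdsGT_zero.comp (tendsto_nhdsWithin_iff.mpr ⟨?_, ?_⟩)
    · have : Continuous fun r : ℝ => 1 - r := by fun_prop
      simpa using (this.tendsto 1).mono_left nhdsWithin_le_nhds
    · filter_upwards [self_mem_nhdsWithin] with r hr using sub_pos.mpr (mem_Iio.mp hr)
  refine tendsto_atTop_mono' _ ?_ hinv
  filter_upwards [hd.norm.eventually_lt_const (lt_add_one ‖d‖), self_mem_nhdsWithin,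
    mem_nhdsWithin_of_mem_nhds (Ioi_mem_nhds (zero_lt_one' ℝ))] with r h1 h2 h3
  rw [mem_Iio] at h2
  rw [mem_Ioi] at h3
  have hn : ‖(r : ℂ)‖ = r := by rw [Complex.norm_real, Real.norm_of_nonneg h3.le]
  have hrD : (r : ℂ) ∈ unitDisk := mem_unitDisk.mpr (by rwa [hn])
  have h4 : ‖(r : ℂ) - 1‖ = 1 - r := by
    rw [norm_sub_rev, ← Complex.ofReal_one, ← Complex.ofReal_sub, Complex.norm_real,
      Real.norm_of_nonneg (by linarith)]
  have hr1 : 0 < 1 - r := by linarith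
  rw [norm_div, h4, div_lt_iff₀ hr1, norm_sub_rev] at h1
  have h5 := hcf r hrD
  rw [hn] at h5
  have h6 : 1 - ‖f r‖ ≤ 1 - ‖f r‖ ^ 2 := by
    nlinarith [norm_nonneg (f r), mem_unitDisk.mp (hm hrD)]
  have h7 := norm_pos_iff.mpr (sub_ne_zero_of_mem_unitDisk hσ (hm hrD))
  have h8 : ‖σ - f r‖ ^ 2 ≤ ((‖d‖ + 1) * (1 - r)) ^ 2 := pow_le_pow_left₀ h7.le h1.le 2
  rw [le_div_iff₀ (by positivity)]
  calc c / (‖d‖ + 1) ^ 2 * (1 - r)⁻¹ * ‖σ - f r‖ ^ 2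
      ≤ c / (‖d‖ + 1) ^ 2 * (1 - r)⁻¹ * ((‖d‖ + 1) * (1 - r)) ^ 2 := by gcongr
    _ = c * (1 - r) := by field_simp
    _ ≤ _ := h5.trans h6

/-- If a conformal map `f` of the disk onto the petal has angular limit `σ` and a finite angular
derivative at `1`, then in strip coordinates `f` sends `1` to `-∞`: finite boundary points are
excluded by the boundedness of the Poisson kernel there, and `+∞` corresponds to the
Denjoy–Wolff point. -/
theorem tendsto_stripInv_comp_one (hφ : IsOneParameterSemigroup φ) (hh : IsKoenigsFunction φ h)
    (hell : IsNonElliptic φ) (hk : IsKoenigsInverse h k) (hΔD : Δ ⊆ unitDisk)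
    (hΔ : IsHyperbolicPetal φ Δ σ) (himg : h '' Δ = hstrip a b) (hab : a < b) {f : ℂ → ℂ}
    (hf : IsConformalOnto f unitDisk Δ) (hfσ : HasAngularLimitAtOne f σ) {d : ℂ}
    (hfd : HasAngularLimitAtOne (fun z => (f z - σ) / (z - 1)) d) :
    Tendsto (fun z => stripInv a b (h (f z))) (𝓝[unitDisk] 1) (𝓝 1) := by
  have hσ1 := hΔ.alpha.norm_eq_one hφ hh hΔD himg hab
  have hL : 0 < (b - a) / Real.pi := div_pos (by linarith) Real.pi_pos
  have hfm : MapsTo f unitDisk unitDisk := fun z hz => hΔD (hf.mapsTo hz)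
  have hhf : IsConformalOnto (fun z => h (f z)) unitDisk (hstrip a b) :=
    IsConformalOnto.comp ⟨hh.holo.mono hΔD, hh.inj.mono hΔD, himg⟩ hf
  set m : ℂ → ℂ := fun z => stripInv a b (h (f z)) with hmdef
  have hm : IsConformalOnto m unitDisk unitDisk := (isConformalOnto_stripInv hab).comp hhf
  have hqm : ∀ z ∈ unitDisk, stripMap a b (m z) = h (f z) := fun z hz =>
    stripMap_stripInv (hhf.mapsTo hz)
  obtain ⟨ω, e, hω1, hω, he⟩ := hm.exists_boundary_value
  suffices hωeq : ω = 1 by rwa [hωeq] at hω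
  have hrad : Tendsto (fun r : ℝ => (r : ℂ)) (𝓝[<] 1) (𝓝[unitDisk] 1) :=
    tendsto_radius_stolzSet.mono_right (nhdsWithin_mono _ (stolzSet_subset_unitDisk 2))
  have hradD : ∀ᶠ r : ℝ in 𝓝[<] 1, (r : ℂ) ∈ unitDisk :=
    (tendsto_nhdsWithin_iff.mp hrad).2
  have hmr := hω.comp hrad
  have hV := tendsto_poisson_atTop (hf.holo) hfm hσ1
    ((hfd 2).comp tendsto_radius_stolzSet)
  -- the real part of `h (f r)` is unbounded as `r → 1`
  have hunb : ∀ B : ℝ, ∀ᶠ r : ℝ in 𝓝[<] 1, B < |(stripMap a b (m r)).re| := by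
    intro B
    obtain ⟨C, hC⟩ := exists_poisson_le hφ hh hk hΔD hΔ.alpha himg hab B
    filter_upwards [hV.eventually_gt_atTop C, hradD] with r h1 h2
    by_contra! h3
    rw [hqm r h2] at h3
    have h4 := hC _ (hhf.mapsTo h2) h3
    rw [hk.left _ (hfm h2)] at h4
    linarith
  by_contra hne
  by_cases hne' : ω = -1
  · subst hne'
    -- `f r` tends to the Denjoy–Wolff point
    obtain ⟨τ, hτ1, hτ⟩ := hell
    obtain ⟨c, hc, hcm⟩ := exists_mul_one_sub_norm_le hm.holo hm.mapsTo
    set δ := c / (2 * (‖e‖ + 1)) with hδ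
    have hδ0 : 0 < δ := by positivity
    set η := (b - a) / Real.pi * δ with hη
    have hη0 : 0 < η := mul_pos hL hδ0
    have him : ∀ᶠ r : ℝ in 𝓝[<] 1, (stripMap a b (m r)).im ∈ Icc (a + η) (b - η) := by
      filter_upwards [(he.comp hrad).norm.eventually_lt_const (lt_add_one ‖e‖), hradD,
        self_mem_nhdsWithin, mem_nhdsWithin_of_mem_nhds (Ioi_mem_nhds (zero_lt_one' ℝ))]
        with r h1 h2 h3 h4
      rw [mem_Iio] at h3
      rw [mem_Ioi] at h4
      refine stripMap_im_bounds hab (hm.mapsTo h2) ?_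
      have h5 : ‖(r : ℂ) - 1‖ = 1 - r := by
        rw [norm_sub_rev, ← Complex.ofReal_one, ← Complex.ofReal_sub, Complex.norm_real,
          Real.norm_of_nonneg (by linarith)]
      have h6 : ‖1 + m r‖ < (‖e‖ + 1) * (1 - r) := by
        rw [Function.comp, norm_div, h5, div_lt_iff₀ (by linarith)] at h1
        rw [sub_neg_eq_add, add_comm] at h1
        exact h1
      have h7 := hcm r h2
      rw [Complex.norm_real, Real.norm_of_nonneg h4.le] at h7
      have h8 := mem_unitDisk.mp (hm.mapsTo h2)
      have h9 : ‖1 - m r‖ ≤ 2 := (norm_sub_le _ _).trans (by rw [norm_one]; linarith)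
      calc δ * (‖1 - m r‖ * ‖1 + m r‖) ≤ δ * (2 * ((‖e‖ + 1) * (1 - r))) := by gcongr
        _ = c * (1 - r) := by rw [hδ]; field_simp
        _ ≤ 1 - ‖m r‖ := h7
        _ ≤ 1 - ‖m r‖ ^ 2 := by nlinarith [norm_nonneg (m r)]
    have hre : Tendsto (fun r : ℝ => (stripMap a b (m r)).re) (𝓝[<] 1) atTop := by
      simp only [stripMap_re]
      refine Tendsto.const_mul_atTop hL (Real.tendsto_log_atTop.comp ?_)
      have h1 : Tendsto (fun r : ℝ => ‖1 - m r‖) (𝓝[<] 1) (𝓝 2) := by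
        have := (hmr.const_sub 1).norm
        norm_num at this
        exact this
      have h2 : Tendsto (fun r : ℝ => ‖1 + m r‖⁻¹) (𝓝[<] 1) atTop := by
        refine tendsto_inv_nhdsGT_zero.comp (tendsto_nhdsWithin_iff.mpr ⟨?_, ?_⟩)
        · simpa using (hmr.const_add 1).norm
        · filter_upwards [hradD] with r hr
          exact norm_pos_iff.mpr (one_add_ne_zero_of_mem (hm.mapsTo hr))
      simpa only [div_eq_mul_inv] using h1.pos_mul_atTop two_pos h2
    set K : Set ℂ := k '' ((fun y : ℝ => (y * Complex.I : ℂ)) '' Icc (a + η) (b - η)) with hK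
    have hsub : (fun y : ℝ => (y * Complex.I : ℂ)) '' Icc (a + η) (b - η) ⊆ h '' unitDisk := by
      rintro _ ⟨y, hy, rfl⟩
      have : (y * Complex.I : ℂ) ∈ h '' Δ := by
        rw [himg]
        constructor <;> simp <;> linarith [hy.1, hy.2]
      exact image_mono hΔD this
    have hKc : IsCompact K := (isCompact_Icc.image (by fun_prop)).image_of_continuousOn
      (hk.conformal.holo.continuousOn.mono hsub)
    have hKD : K ⊆ unitDisk := by
      rintro _ ⟨w, hw, rfl⟩
      exact hk.conformal.mapsTo (hsub hw)
    have h1 := hτ.tendsto_of_compact hφ (by simpa using hτ1) hKc hKD hre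
      (z := fun r : ℝ => k ((stripMap a b (m r)).im * Complex.I))
      (him.mono fun r hr => mem_image_of_mem _ (mem_image_of_mem _ hr))
    have h2 : Tendsto (fun r : ℝ => f r) (𝓝[<] 1) (𝓝 τ) := by
      refine h1.congr' ?_
      filter_upwards [him, hre.eventually_ge_atTop 0, hradD] with r h3 h4 h5
      rw [hk.semigroup_apply hφ hh (hsub (mem_image_of_mem _ h3)) h4, add_comm,
        Complex.re_add_im, hqm _ h5, hk.left _ (hfm h5)]
    have h3 := tendsto_nhds_unique h2 ((hfσ 2).comp tendsto_radius_stolzSet)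
    exact hΔ.ne_dw (h3 ▸ hτ)
  · have h1 : 0 < ‖1 - ω‖ := norm_pos_iff.mpr (sub_ne_zero.mpr (Ne.symm hne))
    have h2 : 0 < ‖1 + ω‖ := norm_pos_iff.mpr fun h0 => hne' (by linear_combination h0)
    have h3 : Tendsto (fun r : ℝ => |(stripMap a b (m r)).re|) (𝓝[<] 1)
        (𝓝 |(b - a) / Real.pi * Real.log (‖1 - ω‖ / ‖1 + ω‖)|) := by
      simp only [stripMap_re]
      refine (Tendsto.const_mul _ (Tendsto.log ?_ (div_pos h1 h2).ne')).abs
      exact (hmr.const_sub 1).norm.div (hmr.const_add 1).norm h2.ne'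
    obtain ⟨r, h4, h5⟩ := ((hunb _).and (h3.eventually_lt_const (lt_add_one _))).exists
    exact absurd (h4.trans h5) (lt_irrefl _)

/-- Conformality of the petal at the `α`-point may be tested on the conformal map given by the
strip coordinate. -/
theorem isConformalInDiskAt_iff (hφ : IsOneParameterSemigroup φ) (hh : IsKoenigsFunction φ h)
    (hell : IsNonElliptic φ) (hk : IsKoenigsInverse h k) (hΔD : Δ ⊆ unitDisk)
    (hΔ : IsHyperbolicPetal φ Δ σ) (himg : h '' Δ = hstrip a b) (hab : a < b) :
    IsConformalInDiskAt Δ σ ↔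
      ∃ d : ℂ, HasAngularLimitAtOne (fun ζ => (k (stripMap a b ζ) - σ) / (ζ - 1)) d := by
  constructor
  · rintro ⟨f, hf, hfσ, d, hfd⟩
    have hhf : IsConformalOnto (fun z => h (f z)) unitDisk (hstrip a b) :=
      IsConformalOnto.comp ⟨hh.holo.mono hΔD, hh.inj.mono hΔD, himg⟩ hf
    have hm := (isConformalOnto_stripInv hab).comp hhf
    have hm1 := tendsto_stripInv_comp_one hφ hh hell hk hΔD hΔ himg hab hf hfσ hfd
    obtain ⟨-, n, hn, hnm, hmn⟩ := hm.exists_inverse isOpen_unitDisk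
    obtain ⟨κ, e, -, hκ, he⟩ := hn.exists_boundary_value
    have hrad : Tendsto (fun r : ℝ => (r : ℂ)) (𝓝[<] 1) (𝓝[unitDisk] 1) :=
      tendsto_radius_stolzSet.mono_right (nhdsWithin_mono _ (stolzSet_subset_unitDisk 2))
    have hm1' : Tendsto (fun z => stripInv a b (h (f z))) (𝓝[unitDisk] 1) (𝓝[unitDisk] 1) :=
      tendsto_nhdsWithin_iff.mpr ⟨hm1, by
        filter_upwards [self_mem_nhdsWithin] with z hz using hm.mapsTo hz⟩
    have hκ1 : κ = 1 := by
      refine tendsto_nhds_unique ((hκ.comp hm1').comp hrad)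
        (((tendsto_nhdsWithin_iff.mp hrad).1).congr' ?_)
      filter_upwards [(tendsto_nhdsWithin_iff.mp hrad).2] with r hr
      exact (hnm _ hr).symm
    subst hκ1
    refine ⟨d * e, fun M => ?_⟩
    obtain ⟨M', hM'⟩ := tendsto_stolzSet_of_slope hn.holo hn.mapsTo hκ he M
    have hle : 𝓝[Complex.stolzSet M] (1 : ℂ) ≤ 𝓝[unitDisk] 1 :=
      nhdsWithin_mono _ (stolzSet_subset_unitDisk M)
    refine (((hfd M').comp hM').mul (he.mono_left hle)).congr' ?_
    filter_upwards [self_mem_nhdsWithin] with ζ hζ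
    have hζD := stolzSet_subset_unitDisk M hζ
    have h1 : n ζ - 1 ≠ 0 := by
      rw [← neg_sub, neg_ne_zero]
      exact one_sub_ne_zero_of_mem (hn.mapsTo hζD)
    have h2 : k (stripMap a b ζ) = f (n ζ) := by
      conv_lhs => rw [← hmn ζ hζD]
      rw [stripMap_stripInv (hhf.mapsTo (hn.mapsTo hζD)), hk.left _ (hΔD (hf.mapsTo
        (hn.mapsTo hζD)))]
    rw [h2, Function.comp, div_mul_div_cancel₀ h1]
  · rintro ⟨d, hd⟩
    refine ⟨_, isConformalOnto_comp_stripMap hk hΔD himg hab, fun M => ?_, d, hd⟩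
    have h1 : Tendsto (fun ζ : ℂ => ζ - 1) (𝓝[Complex.stolzSet M] 1) (𝓝 0) := by
      have : Continuous (fun ζ : ℂ => ζ - 1) := by fun_prop
      simpa using (this.tendsto 1).mono_left nhdsWithin_le_nhds
    have h2 := ((hd M).mul h1).add_const σ
    rw [mul_zero, zero_add] at h2
    refine h2.congr' ?_
    filter_upwards [self_mem_nhdsWithin] with ζ hζ
    have h3 : ζ - 1 ≠ 0 := by
      rw [← neg_sub, neg_ne_zero]
      exact one_sub_ne_zero_of_mem (stolzSet_subset_unitDisk M hζ)
    rw [div_mul_cancel₀ _ h3, sub_add_cancel]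

end Koenigs

/-! ### Comparison of the two conformality conditions -/

section Strip

variable {a b : ℝ}

theorem stripExp_div_eq {v w : ℂ} (hv : v ∈ hstrip a b) (hw : w ∈ hstrip a b) :
    stripExp a b v / stripExp a b w = (1 - stripInv a b v) / (1 - stripInv a b w) *
      ((1 + stripInv a b w) / (1 + stripInv a b v)) := by
  have hab : a < b := hv.1.trans hv.2
  have h1 := stripExp_stripMap hab (stripInv_mem hv)
  have h2 := stripExp_stripMap hab (stripInv_mem hw)
  rw [stripMap_stripInv hv] at h1
  rw [stripMap_stripInv hw] at h2
  have n1 := one_add_ne_zero_of_mem (stripInv_mem hv)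
  have n2 := one_sub_ne_zero_of_mem (stripInv_mem hw)
  have n3 := one_add_ne_zero_of_mem (stripInv_mem hw)
  rw [h1, h2]
  field_simp [Complex.I_ne_zero]

theorem stripExp_re (a b : ℝ) (w : ℂ) : (stripExp a b w).re =
    Real.exp (Real.pi / (b - a) * w.re) * Real.cos (Real.pi / (b - a) * (w.im - a)) := by
  rw [stripExp, Complex.exp_re, Complex.re_ofReal_mul, Complex.im_ofReal_mul]
  simp

/-- If `g` maps the strip to itself and `exp (π (g w - w) / (b - a))` has a nonzero limit `D` as
`w → -∞` in the sets `stripTail`, then `D` is positive: on the line at height `a + (b - a) θ / π`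
the values `stripExp a b (g w)` lie in the upper half-plane and have argument about `θ + arg D`. -/
theorem pos_of_tendsto_stripExp_div (hab : a < b) {g : ℂ → ℂ}
    (hg : MapsTo g (hstrip a b) (hstrip a b)) {D : ℂ} (hD : D ≠ 0)
    (hlim : ∀ ε ∈ Ioo 0 (b - a), Tendsto (fun w => stripExp a b (g w) / stripExp a b w)
      (Bornology.cobounded ℂ ⊓ 𝓟 (stripTail a b ε)) (𝓝 D)) : D.im = 0 ∧ 0 < D.re := by
  have hL : 0 < b - a := by linarith
  have key : ∀ θ ∈ Ioo 0 Real.pi, 0 ≤ D.re * Real.sin θ + D.im * Real.cos θ := by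
    intro θ hθ
    set η := (b - a) / Real.pi * θ with hη
    have hη0 : 0 < η := mul_pos (div_pos hL Real.pi_pos) hθ.1
    have hη1 : η < b - a := by
      rw [hη, div_mul_eq_mul_div, div_lt_iff₀ Real.pi_pos]
      exact mul_lt_mul_of_pos_left hθ.2 hL
    have hε : min η (b - a - η) ∈ Ioo 0 (b - a) :=
      ⟨lt_min hη0 (by linarith), (min_le_left _ _).trans_lt hη1⟩
    have m1 := min_le_left η (b - a - η)
    have m2 := min_le_right η (b - a - η)
    have hl := (hlim _ hε).comp
      (tendsto_line_stripTail hab (y := a + η) hε.1 (by linarith) (by linarith))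
    have hl2 := (((Complex.continuous_re.tendsto _).comp hl).mul_const (Real.sin θ)).add
      (((Complex.continuous_im.tendsto _).comp hl).mul_const (Real.cos θ))
    refine ge_of_tendsto hl2 (Eventually.of_forall fun t => ?_)
    set w : ℂ := t + ((a + η : ℝ) : ℂ) * Complex.I with hw
    have hwim : w.im = a + η := by
      rw [hw, Complex.add_im, Complex.im_ofReal_mul]; simp
    have hwS : w ∈ hstrip a b := ⟨by rw [hwim]; linarith, by rw [hwim]; linarith⟩
    have h1 : Real.pi / (b - a) * (w.im - a) = θ := by
      rw [hwim, hη]; field_simp; ring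
    have h2 := stripExp_im_pos (hg hwS)
    rw [← div_mul_cancel₀ (stripExp a b (g w)) (stripExp_ne_zero a b w), Complex.mul_im,
      stripExp_im, stripExp_re, h1] at h2
    have h3 := Real.exp_pos (Real.pi / (b - a) * w.re)
    simp only [Function.comp]
    refine le_of_lt (pos_of_mul_pos_right (a := Real.exp (Real.pi / (b - a) * w.re)) ?_ h3.le)
    linarith
  have key2 : ∀ θ ∈ Icc 0 Real.pi, 0 ≤ D.re * Real.sin θ + D.im * Real.cos θ := by
    have hcl : IsClosed {θ : ℝ | 0 ≤ D.re * Real.sin θ + D.im * Real.cos θ} :=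
      isClosed_le continuous_const (by fun_prop)
    rw [← closure_Ioo Real.pi_pos.ne]
    exact closure_minimal key hcl
  have h0 := key2 0 ⟨le_rfl, Real.pi_pos.le⟩
  have h1 := key2 Real.pi ⟨Real.pi_pos.le, le_rfl⟩
  have h2 := key2 (Real.pi / 2) ⟨by linarith [Real.pi_pos], by linarith [Real.pi_pos]⟩
  simp only [Real.sin_zero, Real.cos_zero, Real.sin_pi, Real.cos_pi, Real.sin_pi_div_two,
    Real.cos_pi_div_two, mul_zero, mul_one, zero_add, add_zero, mul_neg] at h0 h1 h2
  have him : D.im = 0 := by linarith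
  exact ⟨him, lt_of_le_of_ne h2 fun h => hD (Complex.ext h.symm him)⟩

/-- For self-maps of the strip, taking logarithms is harmless because `Im (g w - w)` lies in
`(a - b, b - a)`. -/
theorem tendsto_sub_of_tendsto_stripExp_div {g : ℂ → ℂ}
    (hg : MapsTo g (hstrip a b) (hstrip a b)) {D : ℝ} (hD : 0 < D) {l : Filter ℂ}
    (hl : ∀ᶠ w in l, w ∈ hstrip a b)
    (hlim : Tendsto (fun w => stripExp a b (g w) / stripExp a b w) l (𝓝 (D : ℂ))) :
    Tendsto (fun w => g w - w) l (𝓝 (((b - a) / Real.pi * Real.log D : ℝ) : ℂ)) := by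
  have h1 := (hlim.clog (Complex.ofReal_mem_slitPlane.mpr hD)).const_mul
    (((b - a) / Real.pi : ℝ) : ℂ)
  rw [Complex.ofReal_mul, Complex.ofReal_log hD.le]
  refine h1.congr' ?_
  filter_upwards [hl] with w hw
  have hL : 0 < b - a := by linarith [hw.1, hw.2]
  have h2 := hg hw
  have h3 : (((b - a) / Real.pi : ℝ) : ℂ) * ((Real.pi / (b - a) : ℝ) : ℂ) = 1 := by
    rw [← Complex.ofReal_mul]
    field_simp
    simp
  have h4 : (((Real.pi / (b - a) : ℝ) : ℂ) * (g w - w)).im =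
      Real.pi / (b - a) * ((g w).im - w.im) := by
    rw [Complex.im_ofReal_mul, Complex.sub_im]
  have h5 : Real.pi / (b - a) * (b - a) = Real.pi := div_mul_cancel₀ _ hL.ne'
  have h6 := div_pos Real.pi_pos hL
  rw [stripExp_div, Complex.log_exp, ← mul_assoc, h3, one_mul]
  · rw [h4]
    nlinarith [mul_lt_mul_of_pos_left (show -(b - a) < (g w).im - w.im by
      linarith [h2.1, hw.2]) h6]
  · rw [h4]
    nlinarith [mul_lt_mul_of_pos_left (show (g w).im - w.im < b - a by
      linarith [h2.2, hw.1]) h6]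

theorem eventually_mem_stripTail (a b ε : ℝ) :
    ∀ᶠ w in Bornology.cobounded ℂ ⊓ 𝓟 (stripTail a b ε), w ∈ stripTail a b ε :=
  mem_inf_of_right (mem_principal_self _)

/-- An angular derivative at `1` of a holomorphic self-map of the disk is not zero. -/
theorem HasAngularLimitAtOne.slope_ne_zero {F : ℂ → ℂ} (hF : DifferentiableOn ℂ F unitDisk)
    (hm : MapsTo F unitDisk unitDisk) {D : ℂ}
    (hD : HasAngularLimitAtOne (fun ζ => (F ζ - 1) / (ζ - 1)) D) : D ≠ 0 := by
  obtain ⟨c, hc, hcF⟩ := exists_mul_one_sub_norm_le hF hm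
  have h1 := ((hD 2).comp tendsto_radius_stolzSet).norm
  have h2 : c ≤ ‖D‖ := by
    refine ge_of_tendsto h1 ?_
    filter_upwards [(tendsto_nhdsWithin_iff.mp tendsto_radius_stolzSet).2, self_mem_nhdsWithin,
      mem_nhdsWithin_of_mem_nhds (Ioi_mem_nhds (zero_lt_one' ℝ))] with r hr hr1 hr0
    rw [mem_Iio] at hr1
    rw [mem_Ioi] at hr0
    have hrD := stolzSet_subset_unitDisk 2 hr
    have h3 := hcF r hrD
    have h4 : ‖(r : ℂ) - 1‖ = 1 - ‖(r : ℂ)‖ := by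
      rw [norm_sub_rev, ← Complex.ofReal_one, ← Complex.ofReal_sub, Complex.norm_real,
        Complex.norm_real, Real.norm_of_nonneg (by linarith), Real.norm_of_nonneg hr0.le]
    have h5 : 0 < 1 - ‖(r : ℂ)‖ := by linarith [mem_unitDisk.mp hrD]
    rw [Function.comp, norm_div, h4, le_div_iff₀ h5, norm_sub_rev]
    have h6 := norm_sub_norm_le 1 (F r)
    rw [norm_one] at h6
    linarith
  intro h0
  rw [h0, norm_zero] at h2
  linarith

end Strip

section Koenigs

variable {φ : ℝ → ℂ → ℂ} {h k : ℂ → ℂ} {Δ : Set ℂ} {σ : ℂ} {a b : ℝ}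

/-- An angular derivative in the disk yields conformality of the Koenigs domain at `-∞`. The
witness is the strip coordinate of the rotated disk, `stripMap a b (conj σ * k w)`. -/
theorem IsKoenigsInverse.isConformalAtNegInfty (hφ : IsOneParameterSemigroup φ)
    (hh : IsKoenigsFunction φ h) (hk : IsKoenigsInverse h k) (hΔD : Δ ⊆ unitDisk)
    (hσ : IsAlphaPoint φ Δ σ) (himg : h '' Δ = hstrip a b) (hab : a < b) {d : ℂ}
    (hd : HasAngularLimitAtOne (fun ζ => (k (stripMap a b ζ) - σ) / (ζ - 1)) d) :
    IsConformalAtNegInfty (h '' unitDisk) a b := by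
  have hσ1 := hσ.norm_eq_one hφ hh hΔD himg hab
  have hσc : conj σ * σ = 1 := by rw [Complex.conj_mul']; simp [hσ1]
  have hS : hstrip a b ⊆ h '' unitDisk := himg ▸ image_mono hΔD
  have hrot : IsConformalOnto (fun z => conj σ * z) unitDisk unitDisk := by
    have hn : ‖conj σ‖ = 1 := by rw [RCLike.norm_conj, hσ1]
    have h0 : conj σ ≠ 0 := by rw [← norm_ne_zero_iff, hn]; exact one_ne_zero
    refine ⟨by fun_prop, fun z _ w _ hzw => mul_left_cancel₀ h0 hzw, ?_⟩
    ext z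
    constructor
    · rintro ⟨w, hw, rfl⟩
      rw [mem_unitDisk, norm_mul, hn, one_mul]
      exact mem_unitDisk.mp hw
    · intro hz
      refine ⟨σ * z, ?_, by simp only [← mul_assoc, hσc, one_mul]⟩
      rw [mem_unitDisk, norm_mul, hσ1, one_mul]
      exact mem_unitDisk.mp hz
  set g : ℂ → ℂ := fun w => stripMap a b (conj σ * k w) with hgdef
  have hg : IsConformalOnto g (h '' unitDisk) (hstrip a b) :=
    (isConformalOnto_stripMap hab).comp (hrot.comp hk.conformal)
  have hgS : MapsTo g (hstrip a b) (hstrip a b) := fun w hw => hg.mapsTo (hS hw)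
  have hpg : ∀ w ∈ hstrip a b, stripInv a b (g w) = conj σ * k w := fun w hw =>
    stripInv_stripMap hab (hrot.mapsTo (hk.conformal.mapsTo (hS hw)))
  set F : ℂ → ℂ := fun ζ => conj σ * k (stripMap a b ζ) with hFdef
  have hFm : MapsTo F unitDisk unitDisk := fun ζ hζ =>
    hrot.mapsTo (hk.conformal.mapsTo (hS (stripMap_mem hab hζ)))
  have hFd : DifferentiableOn ℂ F unitDisk :=
    hrot.holo.comp (isConformalOnto_comp_stripMap hk hΔD himg hab).holo
      fun ζ hζ => hk.conformal.mapsTo (hS (stripMap_mem hab hζ))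
  have hFD : HasAngularLimitAtOne (fun ζ => (F ζ - 1) / (ζ - 1)) (conj σ * d) := by
    intro M
    refine ((hd M).const_mul (conj σ)).congr fun ζ => ?_
    rw [← mul_div_assoc, mul_sub, hσc]
  have hD0 := hFD.slope_ne_zero hFd hFm
  have hF1 : HasAngularLimitAtOne F 1 := by
    intro M
    have h1 : Tendsto (fun ζ : ℂ => ζ - 1) (𝓝[Complex.stolzSet M] 1) (𝓝 0) := by
      have : Continuous (fun ζ : ℂ => ζ - 1) := by fun_prop
      simpa using (this.tendsto 1).mono_left nhdsWithin_le_nhds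
    have h2 := ((hFD M).mul h1).add_const 1
    rw [mul_zero, zero_add] at h2
    refine h2.congr' ?_
    filter_upwards [self_mem_nhdsWithin] with ζ hζ
    have h3 : ζ - 1 ≠ 0 := by
      rw [← neg_sub, neg_ne_zero]
      exact one_sub_ne_zero_of_mem (stolzSet_subset_unitDisk M hζ)
    rw [div_mul_cancel₀ _ h3, sub_add_cancel]
  have hlim : ∀ ε ∈ Ioo 0 (b - a), Tendsto (fun w => stripExp a b (g w) / stripExp a b w)
      (Bornology.cobounded ℂ ⊓ 𝓟 (stripTail a b ε)) (𝓝 (conj σ * d)) := by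
    intro ε hε
    obtain ⟨M, hM⟩ := tendsto_stripInv hab hε
    have h1 : Tendsto (fun ζ => (F ζ - 1) / (ζ - 1) * ((1 + ζ) / (1 + F ζ)))
        (𝓝[Complex.stolzSet M] 1) (𝓝 (conj σ * d * ((1 + 1) / (1 + 1)))) := by
      refine (hFD M).mul (Tendsto.div ?_ ((hF1 M).const_add 1) (by norm_num))
      exact (tendsto_id.mono_left nhdsWithin_le_nhds).const_add 1
    rw [div_self (by norm_num), mul_one] at h1
    refine (h1.comp hM).congr' ?_
    filter_upwards [eventually_mem_stripTail a b ε] with w hw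
    rw [stripExp_div_eq (hgS hw.1) hw.1, hpg w hw.1, Function.comp, hFdef]
    simp only [stripMap_stripInv hw.1]
    rw [← neg_sub, ← neg_sub (1 : ℂ) (stripInv a b w), neg_div_neg_eq]
  obtain ⟨hDim, hDre⟩ := pos_of_tendsto_stripExp_div hab hgS hD0 hlim
  have hDeq : conj σ * d = ((conj σ * d).re : ℂ) := Complex.ext (by simp) (by simp [hDim])
  have hsub : ∀ ε ∈ Ioo 0 (b - a), ∃ c : ℝ, Tendsto (fun z => g z - z)
      (Bornology.cobounded ℂ ⊓ 𝓟 (stripTail a b ε)) (𝓝 (c : ℂ)) := by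
    intro ε hε
    refine ⟨_, tendsto_sub_of_tendsto_stripExp_div hgS hDre
      ((eventually_mem_stripTail a b ε).mono fun w hw => hw.1) ?_⟩
    rw [← hDeq]
    exact hlim ε hε
  refine ⟨g, hg, ⟨(a + b) / 2, ⟨by linarith, by linarith⟩, ?_⟩, hsub⟩
  obtain ⟨c, hc⟩ := hsub ((b - a) / 2) ⟨by linarith, by linarith⟩
  have hline := tendsto_line_stripTail hab (ε := (b - a) / 2) (y := (a + b) / 2)
    (by linarith) (by linarith) (by linarith)
  have h1 := (Complex.continuous_re.tendsto _).comp (hc.comp hline)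
  refine (h1.add_atBot tendsto_id).congr fun t => ?_
  simp

/-- Conformality of the Koenigs domain at `-∞` yields an angular derivative in the disk: in the
coordinate `stripInv a b ∘ g ∘ h`, an automorphism of the disk, the conformal map onto the petal
has an angular derivative at `1`. -/
theorem IsConformalAtNegInfty.exists_angular_derivative (hφ : IsOneParameterSemigroup φ)
    (hh : IsKoenigsFunction φ h) (hk : IsKoenigsInverse h k) (hΔD : Δ ⊆ unitDisk)
    (hσ : IsAlphaPoint φ Δ σ) (himg : h '' Δ = hstrip a b) (hab : a < b)
    (H : IsConformalAtNegInfty (h '' unitDisk) a b) :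
    ∃ d : ℂ, HasAngularLimitAtOne (fun ζ => (k (stripMap a b ζ) - σ) / (ζ - 1)) d := by
  obtain ⟨g, hg, -, hlim⟩ := H
  have hS : hstrip a b ⊆ h '' unitDisk := himg ▸ image_mono hΔD
  have hgS : MapsTo g (hstrip a b) (hstrip a b) := fun w hw => hg.mapsTo (hS hw)
  have hmid : (a + b) / 2 ∈ Ioo a b := ⟨by linarith, by linarith⟩
  have hline : ∀ ε ∈ Ioo 0 (b - a), Tendsto (fun t : ℝ => (t + ((a + b) / 2 : ℝ) * Complex.I : ℂ))
      atBot (Bornology.cobounded ℂ ⊓ 𝓟 (stripTail a b ε)) := fun ε hε =>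
    tendsto_line_stripTail hab hε.1 (by linarith [hε.2]) (by linarith [hε.2])
  -- the limit does not depend on `ε`
  obtain ⟨c, hc⟩ : ∃ c : ℝ, ∀ ε ∈ Ioo 0 (b - a), Tendsto (fun z => g z - z)
      (Bornology.cobounded ℂ ⊓ 𝓟 (stripTail a b ε)) (𝓝 (c : ℂ)) := by
    have hε0 : (b - a) / 2 ∈ Ioo 0 (b - a) := ⟨by linarith, by linarith⟩
    obtain ⟨c, hc⟩ := hlim _ hε0
    refine ⟨c, fun ε hε => ?_⟩
    obtain ⟨c', hc'⟩ := hlim ε hε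
    rwa [tendsto_nhds_unique (hc.comp (hline _ hε0)) (hc'.comp (hline ε hε))]
  set F : ℂ → ℂ := fun ζ => stripInv a b (g (stripMap a b ζ)) with hFdef
  have hFm : MapsTo F unitDisk unitDisk := fun ζ hζ =>
    stripInv_mem (hgS (stripMap_mem hab hζ))
  set D : ℂ := Complex.exp ((Real.pi / (b - a) : ℝ) * c) with hD
  have hX : ∀ ε ∈ Ioo 0 (b - a), Tendsto (fun w => stripExp a b (g w) / stripExp a b w)
      (Bornology.cobounded ℂ ⊓ 𝓟 (stripTail a b ε)) (𝓝 D) := by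
    intro ε hε
    simp only [stripExp_div]
    exact ((hc ε hε).const_mul _).cexp
  have hpg : ∀ ε ∈ Ioo 0 (b - a), Tendsto (fun w => stripInv a b (g w))
      (Bornology.cobounded ℂ ⊓ 𝓟 (stripTail a b ε)) (𝓝 1) := by
    intro ε hε
    have h1 : Tendsto (fun w => stripExp a b (g w))
        (Bornology.cobounded ℂ ⊓ 𝓟 (stripTail a b ε)) (𝓝 0) := by
      have := (hX ε hε).mul (tendsto_stripExp_stripTail hab ε)
      rw [mul_zero] at this
      exact this.congr fun w => div_mul_cancel₀ _ (stripExp_ne_zero a b w)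
    have h2 : Tendsto (fun w => stripInv a b (g w))
        (Bornology.cobounded ℂ ⊓ 𝓟 (stripTail a b ε))
        (𝓝 ((Complex.I - 0) / (Complex.I + 0))) :=
      (h1.const_sub _).div (h1.const_add _) (by simp)
    simpa using h2
  have hF1 : HasAngularLimitAtOne F 1 := by
    intro M
    obtain ⟨ε, hε, hq⟩ := tendsto_stripMap hab M
    exact (hpg ε hε).comp hq
  have hFD : HasAngularLimitAtOne (fun ζ => (F ζ - 1) / (ζ - 1)) D := by
    intro M
    obtain ⟨ε, hε, hq⟩ := tendsto_stripMap hab M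
    have h1 : Tendsto (fun ζ => (1 + F ζ) / (1 + ζ)) (𝓝[Complex.stolzSet M] 1)
        (𝓝 ((1 + 1) / (1 + 1))) :=
      ((hF1 M).const_add 1).div ((tendsto_id.mono_left nhdsWithin_le_nhds).const_add 1)
        (by norm_num)
    have h2 := ((hX ε hε).comp hq).mul h1
    rw [div_self (by norm_num), mul_one] at h2
    refine h2.congr' ?_
    filter_upwards [self_mem_nhdsWithin] with ζ hζ
    have hζD := stolzSet_subset_unitDisk M hζ
    have hqS := stripMap_mem hab hζD
    have n1 := one_add_ne_zero_of_mem hζD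
    have n2 := one_add_ne_zero_of_mem (hFm hζD)
    rw [Function.comp, stripExp_div_eq (hgS hqS) hqS, stripInv_stripMap hab hζD]
    change (1 - F ζ) / (1 - ζ) * ((1 + ζ) / (1 + F ζ)) * ((1 + F ζ) / (1 + ζ)) = _
    rw [mul_assoc, div_mul_div_cancel₀ n2, div_self n1, mul_one, ← neg_sub, ← neg_sub ζ,
      neg_div_neg_eq]
  have hFD' : ∀ M, Tendsto F (𝓝[Complex.stolzSet M] 1) (𝓝[unitDisk] 1) := fun M =>
    tendsto_nhdsWithin_iff.mpr ⟨hF1 M, by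
      filter_upwards [self_mem_nhdsWithin] with ζ hζ using hFm (stolzSet_subset_unitDisk M hζ)⟩
  -- `j` is the inverse of the automorphism `stripInv a b ∘ g ∘ h`, and `k ∘ stripMap a b = j ∘ F`
  have hauto : IsConformalOnto (fun z => stripInv a b (g (h z))) unitDisk unitDisk :=
    (isConformalOnto_stripInv hab).comp (hg.comp hh.isConformalOnto)
  obtain ⟨-, j, hj, hj1, -⟩ := hauto.exists_inverse isOpen_unitDisk
  have hjF : ∀ w ∈ hstrip a b, j (stripInv a b (g w)) = k w := fun w hw => by
    have := hj1 (k w) (hk.conformal.mapsTo (hS hw))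
    rwa [hk.right w (hS hw)] at this
  obtain ⟨κ, e, -, hκ, he⟩ := hj.exists_boundary_value
  have hκσ : κ = σ := by
    have hε0 : (b - a) / 2 ∈ Ioo 0 (b - a) := ⟨by linarith, by linarith⟩
    have h1 : Tendsto (fun t : ℝ => stripInv a b (g (t + ((a + b) / 2 : ℝ) * Complex.I)))
        atBot (𝓝[unitDisk] 1) :=
      tendsto_nhdsWithin_iff.mpr ⟨(hpg _ hε0).comp (hline _ hε0),
        Eventually.of_forall fun t => stripInv_mem (hgS (line_mem_hstrip hmid t))⟩
    refine tendsto_nhds_unique ((hκ.comp h1).congr fun t => ?_)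
      (hσ.tendsto_line hφ hh hk hΔD himg hmid)
    exact hjF _ (line_mem_hstrip hmid t)
  subst hκσ
  refine ⟨e * D, fun M => ?_⟩
  refine ((he.comp (hFD' M)).mul (hFD M)).congr' ?_
  filter_upwards [self_mem_nhdsWithin] with ζ hζ
  have hζD := stolzSet_subset_unitDisk M hζ
  have h1 : F ζ - 1 ≠ 0 := by
    rw [← neg_sub, neg_ne_zero]
    exact one_sub_ne_zero_of_mem (hFm hζD)
  rw [Function.comp, div_mul_div_cancel₀ h1, hFdef]
  simp only [hjF _ (stripMap_mem hab hζD)]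

end Koenigs

theorem mainTheorem6 (φ : ℝ → ℂ → ℂ) (h : ℂ → ℂ) (Δ : Set ℂ) (σ : ℂ)
    (hφ : IsOneParameterSemigroup φ) (hgroup : NotGroup φ) (hell : IsNonElliptic φ)
    (hh : IsKoenigsFunction φ h) (hΔ : IsHyperbolicPetal φ Δ σ) :
    ∃ a b : ℝ, IsMaximalStrip (h '' unitDisk) a b ∧ h '' Δ = hstrip a b ∧
      (IsConformalInDiskAt Δ σ ↔ IsConformalAtNegInfty (h '' unitDisk) a b) := by
  obtain ⟨hΔD, a, b, hmax, himg⟩ := hΔ.exists_image_eq_hstrip hφ hell hh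
  obtain ⟨k, hk⟩ := hh.exists_inverse
  refine ⟨a, b, hmax, himg, ?_⟩
  rw [isConformalInDiskAt_iff hφ hh hell hk hΔD hΔ himg hmax.1]
  constructor
  · rintro ⟨d, hd⟩
    exact hk.isConformalAtNegInfty hφ hh hΔD hΔ.alpha himg hmax.1 hd
  · exact fun H => H.exists_angular_derivative hφ hh hk hΔD hΔ.alpha himg hmax.1
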